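/- Let $d\in\{2,3\}$ and let $\Omega\subset\mathbb R^d$ be a bounded, simply connected open set; all function spaces consist of complex-valued functions and $(u,v)_0=\int_\Omega u\overline v\,dx$. Let $H_0^s(\Omega)$ ($s=1,2$) be the closure of $C_c^\infty(\Omega)$ in $H^s(\Omega)=W^{s,2}(\Omega)$, with norm $\|\cdot\|_s$, and let $H^{-1}(\Omega)$ be the space of continuous conjugate-linear functionals $g$ on $H_0^1(\Omega)$, written $v\mapsto (g,v)_0$, with norm $\sup_{0\ne v\in H^1_0(\Omega)}|(g,v)_0|/\|v\|_1$; a function $g\in L^2(\Omega)$ is identified with the functional $v\mapsto\int_\Omega g\overline v\,dx$. Put $\mathbf H=H_0^2(\Omega)\times L^2(\Omega)$ and $\mathbf H_1=H_0^1(\Omega)\times H^{-1}(\Omega)$, so that $\mathbf H\subset\mathbf H_1$. Let $n\in W^{1,\infty}(\Omega)$ be real-valued and assume that one of the following holds (almost everywhere in $\Omega$): (C1) $n\ge 1+\delta$ for some constant $\delta>0$; then put $m=n-1$; or (C2) $c\le n\le 1-\beta$ for some constants $c,\beta>0$; then put $m=1-n$. Let $\mu>0$ be a constant with $\mu\le \frac1m$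 almost everywhere in $\Omega$. For $(u,\omega),(v,z)\in\mathbf H$ and $(f,g)\in\mathbf H_1$ let $$A((u,\omega),(v,z))=\Big(\big(\tfrac1m-\mu\big)\Delta u,\Delta v\Big)_0+\mu\int_\Omega\sum_{1\le i,j\le d}\frac{\partial^2u}{\partial x_i\partial x_j}\frac{\partial^2\overline v}{\partial x_i\partial x_j}\,dx+(\omega,z)_0,$$ $$B((f,g),(v,z))=\Big(\nabla\big(\tfrac1mf\big),\nabla v\Big)_0+\Big(\nabla f,\nabla\big(\tfrac nmv\big)\Big)_0-\Big(\tfrac nm g,v\Big)_0+(f,z)_0,$$ where $(\tfrac nm g,v)_0$ means $(g,\tfrac nm v)_0$. **Theorem 2.2.** The form $B$ is well defined, in the sense that $\frac1m f$ and $\frac nm f$ belong to $H_0^1(\Omega)$ for every $f\in H_0^1(\Omega)$. For every $(f,g)\in\mathbf H_1$ there is exactly one $T(f,g)\in\mathbf H$ with $$A(T(f,g),(v,z))=B((f,g),(v,z))\qquad\text{for all }(v,z)\in\mathbf H,$$ and the resulting solution operator $T:\mathbf H_1\to\mathbf H$ is linear and continuous. Moreover $T$ is compact as an operator $\mathbf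 H\to\mathbf H$ (restricted to $\mathbf H$) and as an operator $\mathbf H_1\to\mathbf H_1$ (composed with the inclusion $\mathbf H\subset\mathbf H_1$). -/

import Mathlib

open MeasureTheory TopologicalSpace
open scoped Distributions ENNReal ComplexConjugate

noncomputable section

namespace TransmissionEigenvalue

/-- The Euclidean space `ℝᵈ`. -/
abbrev E (d : ℕ) : Type := EuclideanSpace ℝ (Fin d)

variable {d : ℕ}

/-- The `i`-th coordinate vector of `ℝᵈ`. -/
abbrev e (i : Fin d) : E d := EuclideanSpace.single i (1 : ℝ)

/-- Lebesgue measure on `Ω`. -/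
abbrev vol (Ω : Opens (E d)) : Measure (E d) := volume.restrict (Ω : Set (E d))

/-- The complex space `L²(Ω)`. -/
abbrev L2 (Ω : Opens (E d)) : Type := Lp ℂ 2 (vol Ω)

/-- The partial derivative `∂φ/∂xᵢ` of a test function `φ ∈ C_c^∞(Ω; ℂ)`. -/
def testDeriv {Ω : Opens (E d)} (i : Fin d) (φ : 𝓓(Ω, ℂ)) : 𝓓(Ω, ℂ) where
  toFun x := fderiv ℝ φ x (e i)
  contDiff' := (φ.contDiff.fderiv_right (m := ((⊤ : ℕ∞) : WithTop ℕ∞)) le_rfl).clm_apply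
    contDiff_const
  hasCompactSupport' := φ.hasCompactSupport.fderiv_apply ℝ (e i)
  tsupport_subset' := (tsupport_fderiv_apply_subset ℝ (e i)).trans φ.tsupport_subset

/-- `g` is the weak derivative `∂u/∂xᵢ` on `Ω`:
`∫_Ω u ∂ᵢφ = -∫_Ω g φ` for all test functions `φ`. It is only used for `u`, `g` in `L²(Ω)` or in
`L^∞(Ω)`, so that the integrals converge. -/
def IsWeakDeriv (Ω : Opens (E d)) (i : Fin d) (u g : E d → ℂ) : Prop :=
  ∀ φ : 𝓓(Ω, ℂ), ∫ x in (Ω : Set (E d)), u x * testDeriv i φ x =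
    -∫ x in (Ω : Set (E d)), g x * φ x

/-- The real function `n` belongs to `W^{1,∞}(Ω)`. -/
def MemW1Infty (Ω : Opens (E d)) (n : E d → ℝ) : Prop :=
  MemLp n ∞ (vol Ω) ∧ ∀ i : Fin d, ∃ g : E d → ℝ, MemLp g ∞ (vol Ω) ∧
    IsWeakDeriv Ω i (fun x => (n x : ℂ)) (fun x => (g x : ℂ))

theorem memLp_test {Ω : Opens (E d)} (φ : 𝓓(Ω, ℂ)) : MemLp φ 2 (vol Ω) :=
  φ.continuous.memLp_of_hasCompactSupport φ.hasCompactSupport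

/-- A test function as an element of `L²(Ω)`. -/
def testL2 {Ω : Opens (E d)} (φ : 𝓓(Ω, ℂ)) : L2 Ω := (memLp_test φ).toLp φ

theorem integrable_mul_test {Ω : Opens (E d)} (u : L2 Ω) (φ : 𝓓(Ω, ℂ)) :
    Integrable (fun x => u x * φ x) (vol Ω) :=
  (Lp.memLp u).integrable_mul (memLp_test φ)

theorem IsWeakDeriv.congr {Ω : Opens (E d)} {i : Fin d} {u u' g g' : E d → ℂ}
    (h : IsWeakDeriv Ω i u g) (hu : u' =ᵐ[vol Ω] u) (hg : g' =ᵐ[vol Ω] g) :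
    IsWeakDeriv Ω i u' g' := by
  intro φ
  rw [integral_congr_ae (g := fun x => u x * testDeriv i φ x) (by
      filter_upwards [hu] with x hx; rw [hx]),
    integral_congr_ae (f := fun x => g' x * φ x) (g := fun x => g x * φ x) (by
      filter_upwards [hg] with x hx; rw [hx])]
  exact h φ

theorem IsWeakDeriv.add {Ω : Opens (E d)} {i : Fin d} {u v g h : L2 Ω}
    (hu : IsWeakDeriv Ω i u g) (hv : IsWeakDeriv Ω i v h) :
    IsWeakDeriv Ω i (u + v : L2 Ω) (g + h : L2 Ω) := by
  refine IsWeakDeriv.congr (u := fun x => u x + v x) (g := fun x => g x + h x) ?_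
    (Lp.coeFn_add u v) (Lp.coeFn_add g h)
  intro φ
  simp only [add_mul]
  rw [integral_add (integrable_mul_test u _) (integrable_mul_test v _),
    integral_add (integrable_mul_test g _) (integrable_mul_test h _), hu φ, hv φ]
  ring

theorem IsWeakDeriv.smul {Ω : Opens (E d)} {i : Fin d} {u g : L2 Ω} (c : ℂ)
    (hu : IsWeakDeriv Ω i u g) : IsWeakDeriv Ω i (c • u : L2 Ω) (c • g : L2 Ω) := by
  refine IsWeakDeriv.congr (u := fun x => c * u x) (g := fun x => c * g x) ?_
    (Lp.coeFn_smul c u) (Lp.coeFn_smul c g)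
  intro φ
  simp only [mul_assoc]
  rw [integral_const_mul, integral_const_mul, hu φ]
  ring

theorem isWeakDeriv_zero (Ω : Opens (E d)) (i : Fin d) :
    IsWeakDeriv Ω i (0 : L2 Ω) (0 : L2 Ω) := by
  refine IsWeakDeriv.congr (u := fun _ => 0) (g := fun _ => 0) ?_
    (Lp.coeFn_zero _ _ _) (Lp.coeFn_zero _ _ _)
  intro φ
  simp

theorem isWeakDeriv_test {Ω : Opens (E d)} (i : Fin d) (φ : 𝓓(Ω, ℂ)) :
    IsWeakDeriv Ω i (testL2 φ) (testL2 (testDeriv i φ)) := by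
  refine IsWeakDeriv.congr (u := φ) (g := testDeriv i φ) ?_
    (memLp_test φ).coeFn_toLp (memLp_test _).coeFn_toLp
  intro ψ
  have key : ∀ α β : 𝓓(Ω, ℂ), ∀ x, x ∉ (Ω : Set (E d)) → α x * β x = 0 := by
    intro α β x hx
    rw [image_eq_zero_of_notMem_tsupport (fun h => hx (α.tsupport_subset h)), zero_mul]
  have int : ∀ α β : 𝓓(Ω, ℂ), Integrable (fun x => α x * β x) volume := fun α β =>
    (α.continuous.mul β.continuous).integrable_of_hasCompactSupport
      (α.hasCompactSupport.mul_right)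
  rw [setIntegral_eq_integral_of_forall_compl_eq_zero (key φ (testDeriv i ψ)),
    setIntegral_eq_integral_of_forall_compl_eq_zero (key (testDeriv i φ) ψ)]
  exact integral_mul_fderiv_eq_neg_fderiv_mul_of_integrable (int (testDeriv i φ) ψ)
    (int φ (testDeriv i ψ)) (int φ ψ)
    (fun x _ => (φ.contDiff.differentiable (by simp)) x)
    (fun x _ => (ψ.contDiff.differentiable (by simp)) x)

/-- First-order jets: pairs `(u, (uᵢ)ᵢ)` in `L²(Ω) × L²(Ω)ᵈ`, with the Hilbert norm
`(‖u‖₀² + ∑ᵢ ‖uᵢ‖₀²)^{1/2}`. -/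
abbrev Jet1 (Ω : Opens (E d)) : Type := WithLp 2 (L2 Ω × PiLp 2 (fun _ : Fin d => L2 Ω))

/-- Second-order jets `((u, (uᵢ)ᵢ), (uᵢⱼ)ᵢⱼ)`, with the Hilbert norm
`(‖u‖₀² + ∑ᵢ ‖uᵢ‖₀² + ∑ᵢⱼ ‖uᵢⱼ‖₀²)^{1/2}`. -/
abbrev Jet2 (Ω : Opens (E d)) : Type :=
  WithLp 2 (Jet1 Ω × PiLp 2 (fun _ : Fin d × Fin d => L2 Ω))

/-- The Sobolev space `H¹(Ω) = W^{1,2}(Ω)`. An element `u` is stored together with its weak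
gradient (which `u` determines) as the jet `(u, ∇u)`; the norm is the usual one,
`‖u‖₁ = (‖u‖₀² + ∑ᵢ ‖∂ᵢu‖₀²)^{1/2}`. -/
def H1 (Ω : Opens (E d)) : Submodule ℂ (Jet1 Ω) where
  carrier := {U | ∀ i, IsWeakDeriv Ω i U.fst (U.snd i)}
  add_mem' hU hV i := (hU i).add (hV i)
  zero_mem' i := isWeakDeriv_zero Ω i
  smul_mem' c _ hU i := (hU i).smul c

/-- The Sobolev space `H²(Ω) = W^{2,2}(Ω)`: an element `u` is stored as the jet
`((u, ∇u), (∂²u/∂xᵢ∂xⱼ)ᵢⱼ)` of its weak derivatives, so `‖u‖₂` is the norm of this jet. -/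
def H2 (Ω : Opens (E d)) : Submodule ℂ (Jet2 Ω) where
  carrier := {U | U.fst ∈ H1 Ω ∧ ∀ i j, IsWeakDeriv Ω j (U.fst.snd i) (U.snd (i, j))}
  add_mem' hU hV := ⟨(H1 Ω).add_mem hU.1 hV.1, fun i j => (hU.2 i j).add (hV.2 i j)⟩
  zero_mem' := ⟨(H1 Ω).zero_mem, fun _ j => isWeakDeriv_zero Ω j⟩
  smul_mem' c _ hU := ⟨(H1 Ω).smul_mem c hU.1, fun i j => (hU.2 i j).smul c⟩

/-- The jet `(φ, ∇φ)` of a test function. -/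
def testJet1 {Ω : Opens (E d)} (φ : 𝓓(Ω, ℂ)) : Jet1 Ω :=
  WithLp.toLp 2 (testL2 φ, WithLp.toLp 2 fun i => testL2 (testDeriv i φ))

/-- The jet `((φ, ∇φ), D²φ)` of a test function. -/
def testJet2 {Ω : Opens (E d)} (φ : 𝓓(Ω, ℂ)) : Jet2 Ω :=
  WithLp.toLp 2 (testJet1 φ, WithLp.toLp 2 fun p => testL2 (testDeriv p.2 (testDeriv p.1 φ)))

theorem testJet1_mem_H1 {Ω : Opens (E d)} (φ : 𝓓(Ω, ℂ)) : testJet1 φ ∈ H1 Ω :=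
  fun i => isWeakDeriv_test i φ

theorem testJet2_mem_H2 {Ω : Opens (E d)} (φ : 𝓓(Ω, ℂ)) : testJet2 φ ∈ H2 Ω :=
  ⟨testJet1_mem_H1 φ, fun i j => isWeakDeriv_test j (testDeriv i φ)⟩

/-- `H₀¹(Ω)`, the closure of `C_c^∞(Ω)` in `H¹(Ω)`. -/
def H10 (Ω : Opens (E d)) : Submodule ℂ (Jet1 Ω) :=
  H1 Ω ⊓ (Submodule.span ℂ (Set.range (testJet1 (Ω := Ω)))).topologicalClosure

/-- `H₀²(Ω)`, the closure of `C_c^∞(Ω)` in `H²(Ω)`. -/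
def H20 (Ω : Opens (E d)) : Submodule ℂ (Jet2 Ω) :=
  H2 Ω ⊓ (Submodule.span ℂ (Set.range (testJet2 (Ω := Ω)))).topologicalClosure

/-- The inclusion `H₀¹(Ω) → L²(Ω)`. -/
def H10.toL2 (Ω : Opens (E d)) : H10 Ω →L[ℂ] L2 Ω :=
  (WithLp.fstL 2 ℂ (L2 Ω) (PiLp 2 (fun _ : Fin d => L2 Ω))).comp (H10 Ω).subtypeL

/-- The weak derivative `∂u/∂xᵢ ∈ L²(Ω)` of `u ∈ H₀¹(Ω)`. -/
def H10.deriv {Ω : Opens (E d)} (u : H10 Ω) (i : Fin d) : L2 Ω := u.1.snd i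

/-- The weak derivative `∂²u/∂xᵢ∂xⱼ ∈ L²(Ω)` of `u ∈ H₀²(Ω)`. -/
def H20.deriv2 {Ω : Opens (E d)} (u : H20 Ω) (i j : Fin d) : L2 Ω := u.1.snd (i, j)

/-- The Laplacian `Δu ∈ L²(Ω)` of `u ∈ H₀²(Ω)`. -/
def H20.laplacian {Ω : Opens (E d)} (u : H20 Ω) : L2 Ω := ∑ i, H20.deriv2 u i i

/-- Forgetting the second derivatives. -/
def jetFst (Ω : Opens (E d)) : Jet2 Ω →L[ℂ] Jet1 Ω :=
  WithLp.fstL 2 ℂ (Jet1 Ω) (PiLp 2 (fun _ : Fin d × Fin d => L2 Ω))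

theorem jetFst_mem {Ω : Opens (E d)} (u : H20 Ω) : jetFst Ω u.1 ∈ H10 Ω := by
  refine ⟨u.2.1.1, map_mem_closure (jetFst Ω).continuous u.2.2 ?_⟩
  intro x hx
  have : Submodule.span ℂ (Set.range (testJet2 (Ω := Ω))) ≤
      (Submodule.span ℂ (Set.range (testJet1 (Ω := Ω)))).comap (jetFst Ω).toLinearMap := by
    rw [Submodule.span_le]
    rintro _ ⟨φ, rfl⟩
    exact Submodule.subset_span ⟨φ, rfl⟩
  exact this hx

/-- The inclusion `H₀²(Ω) → H₀¹(Ω)`. -/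
def H20.toH10 (Ω : Opens (E d)) : H20 Ω →L[ℂ] H10 Ω :=
  ((jetFst Ω).comp (H20 Ω).subtypeL).codRestrict (H10 Ω) jetFst_mem

/-- The negative space `H^{-1}(Ω)`: the continuous conjugate-linear functionals on `H₀¹(Ω)`, where
`g v` is the pairing `(g, v)₀`. Its norm is the operator norm `sup_{v ≠ 0} |(g, v)₀| / ‖v‖₁`. -/
abbrev Hneg1 (Ω : Opens (E d)) : Type := H10 Ω →L⋆[ℂ] ℂ

/-- The inclusion `L²(Ω) → H^{-1}(Ω)`, sending `z` to the functional `v ↦ (z, v)₀ = ∫_Ω z v̄`. -/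
def L2toHneg1 (Ω : Opens (E d)) : L2 Ω →L[ℂ] Hneg1 Ω :=
  ((innerSL ℂ (E := L2 Ω)).comp (H10.toL2 Ω)).flip

/-- `𝐇 = H₀²(Ω) × L²(Ω)`. -/
abbrev HH (Ω : Opens (E d)) : Type := H20 Ω × L2 Ω

/-- `𝐇₁ = H₀¹(Ω) × H^{-1}(Ω)`. -/
abbrev HH1 (Ω : Opens (E d)) : Type := H10 Ω × Hneg1 Ω

/-- The inclusion `𝐇 → 𝐇₁`. -/
def incl (Ω : Opens (E d)) : HH Ω →L[ℂ] HH1 Ω := (H20.toH10 Ω).prodMap (L2toHneg1 Ω)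

/-- `w ∈ H₀¹(Ω)` is the pointwise product `q u` of `u ∈ H₀¹(Ω)` with the real function `q`. -/
def IsProduct {Ω : Opens (E d)} (q : E d → ℝ) (u w : H10 Ω) : Prop :=
  H10.toL2 Ω w =ᵐ[vol Ω] fun x => (q x : ℂ) * H10.toL2 Ω u x

open Classical in
/-- The product `q u` as an element of `H₀¹(Ω)`, for a multiplier `q` of `H₀¹(Ω)`
(it is set to `0` if `q u` is not in `H₀¹(Ω)`). -/
def mulH10 {Ω : Opens (E d)} (q : E d → ℝ) (u : H10 Ω) : H10 Ω :=
  if h : ∃ w : H10 Ω, IsProduct q u w then h.choose else 0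

/-- Condition (C1) on the index of refraction. -/
def CondC1 (Ω : Opens (E d)) (n : E d → ℝ) : Prop :=
  MemLp n ∞ (vol Ω) ∧ ∃ δ : ℝ, 0 < δ ∧ ∀ᵐ x ∂(vol Ω), 1 + δ ≤ n x

/-- Condition (C2) on the index of refraction. -/
def CondC2 (Ω : Opens (E d)) (n : E d → ℝ) : Prop :=
  MemLp n ∞ (vol Ω) ∧ (∃ c : ℝ, 0 < c ∧ ∀ᵐ x ∂(vol Ω), c ≤ n x) ∧
    ∃ β : ℝ, 0 < β ∧ ∀ᵐ x ∂(vol Ω), n x ≤ 1 - β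

/-- The sesquilinear form
`A((u,ω),(v,z)) = ((1/m - μ) Δu, Δv)₀ + μ ∫_Ω ∑ᵢⱼ ∂ᵢ∂ⱼu ∂ᵢ∂ⱼv̄ + (ω, z)₀`,
to be used with `m = n - 1` under (C1) and `m = 1 - n` under (C2). -/
def formA (Ω : Opens (E d)) (m : E d → ℝ) (μ : ℝ) (U V : HH Ω) : ℂ :=
  (∫ x in (Ω : Set (E d)), ((1 / m x - μ : ℝ) : ℂ) * H20.laplacian U.1 x * conj (H20.laplacian V.1 x)) +
    (μ : ℂ) * (∫ x in (Ω : Set (E d)), ∑ i, ∑ j, H20.deriv2 U.1 i j x * conj (H20.deriv2 V.1 i j x)) +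
    ∫ x in (Ω : Set (E d)), U.2 x * conj (V.2 x)

/-- The sesquilinear form
`B((f,g),(v,z)) = (∇(f/m), ∇v)₀ + (∇f, ∇(n v/m))₀ - (n g/m, v)₀ + (f, z)₀`
for `(f,g) ∈ 𝐇₁` and `(v,z) ∈ 𝐇`; as `n/m` is real, `(n g/m, v)₀` is the value of the functional
`g ∈ H^{-1}(Ω)` at `n v/m ∈ H₀¹(Ω)`. -/
def formB (Ω : Opens (E d)) (n m : E d → ℝ) (F : HH1 Ω) (V : HH Ω) : ℂ :=
  let v : H10 Ω := H20.toH10 Ω V.1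
  (∫ x in (Ω : Set (E d)), ∑ i,
      H10.deriv (mulH10 (fun y => 1 / m y) F.1) i x * conj (H10.deriv v i x)) +
    (∫ x in (Ω : Set (E d)), ∑ i, H10.deriv F.1 i x *
      conj (H10.deriv (mulH10 (fun y => n y / m y) v) i x)) -
    F.2 (mulH10 (fun y => n y / m y) v) +
    ∫ x in (Ω : Set (E d)), H10.toL2 Ω F.1 x * conj (V.2 x)

end TransmissionEigenvalue

end

noncomputable section

namespace TransmissionEigenvalue

/-!
Both forms are turned into bounded operators between Hilbert spaces. Translating a test function `φ`
by `z` changes it in `L²` by at most `‖z · ∇φ‖`, so averaging over the cells of a fine grid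
approximates `H₀¹ → L²` by operators of finite rank. Integration by parts gives
`‖∂ᵢφ‖² ≤ ‖φ‖ ‖∂ᵢ²φ‖`, which makes `H₀² → H₀¹` compact too, and duality makes `L² → H⁻¹` compact.

Multiplication by `q ∈ W^{1,∞}` preserves `H₀¹`, as one sees by mollifying `q`. When `q ≥ δ > 0`
it is coercive for the inner product `(∇u, ∇v) + κ (u, v)` with `κ` large, hence surjective; so
division by `m` preserves `H₀¹` without a chain rule for `1 / m`. Since `1 / m - μ ≥ 0`, the form
`A` dominates `μ` times the squared norm of the Hessian plus `‖ω‖²`, so it is coercive by the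
Poincaré inequality. The Lax–Milgram theorem gives `T`, whose compactness is that of the inclusion
`𝐇 ⊂ 𝐇₁`.
-/

variable {d : ℕ} {Ω : Opens (E d)}

section Hilbert

variable {𝕜 X Y Z : Type*} [RCLike 𝕜]

theorem isCompactOperator_of_norm_sq_le [NormedAddCommGroup X] [NormedSpace 𝕜 X]
    [NormedAddCommGroup Y] [NormedSpace 𝕜 Y] [CompleteSpace Y] [NormedAddCommGroup Z]
    [NormedSpace 𝕜 Z] {T : X →L[𝕜] Y} {K : X →L[𝕜] Z} (hK : IsCompactOperator K) {C : ℝ}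
    (h : ∀ x, ‖T x‖ ^ 2 ≤ C * (‖K x‖ * ‖x‖)) : IsCompactOperator T := by
  let B : Set X := Metric.closedBall 0 1
  have hKB : IsCompact (closure (K '' B)) :=
    (isCompactOperator_iff_isCompact_closure_image_closedBall K.toLinearMap one_pos).1 hK
  refine (isCompactOperator_iff_isCompact_closure_image_closedBall T.toLinearMap one_pos).2 ?_
  suffices hTB : TotallyBounded (T '' B) from
    hTB.closure.isCompact_of_isClosed isClosed_closure
  refine Metric.totallyBounded_iff.2 fun ε hε => ?_
  obtain ⟨η, hη, hηε⟩ : ∃ η > 0, |C| * (η * 2) < ε ^ 2 := by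
    refine ⟨ε ^ 2 / (2 * |C| + 1), by positivity, ?_⟩
    rw [div_mul_eq_mul_div, ← mul_div_assoc, div_lt_iff₀ (by positivity)]
    nlinarith [sq_pos_of_pos hε]
  obtain ⟨s, hsB, hs, hcover⟩ := Set.exists_subset_image_finite_and.1
    (exists_finite_cover_balls_of_isCompact_closure hKB hη)
  refine ⟨T '' s, hs.image T, ?_⟩
  rintro _ ⟨x, hx, rfl⟩
  obtain ⟨_, ⟨y, hy, rfl⟩, hxy⟩ := Set.mem_iUnion₂.1 (hcover (Set.mem_image_of_mem K hx))
  refine Set.mem_iUnion₂.2 ⟨T y, ⟨y, hy, rfl⟩, ?_⟩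
  rw [Metric.mem_ball, dist_eq_norm, ← map_sub] at hxy ⊢
  refine lt_of_pow_lt_pow_left₀ 2 hε.le ?_
  have hnorm : ‖x - y‖ ≤ 2 := by
    have := mem_closedBall_zero_iff.1 hx
    have := mem_closedBall_zero_iff.1 (hsB hy)
    linarith [norm_sub_le x y]
  calc ‖T (x - y)‖ ^ 2 ≤ C * (‖K (x - y)‖ * ‖x - y‖) := h _
    _ ≤ |C| * (η * 2) := by gcongr; exact le_abs_self C
    _ < ε ^ 2 := hηε

theorem isCompactOperator_of_forall_norm_sub_le [NormedAddCommGroup X] [NormedSpace 𝕜 X]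
    [NormedAddCommGroup Y] [NormedSpace 𝕜 Y] [CompleteSpace Y] {T : X →L[𝕜] Y}
    (h : ∀ ε : ℝ, 0 < ε → ∃ S : X →L[𝕜] Y, IsCompactOperator S ∧ ‖T - S‖ ≤ ε) :
    IsCompactOperator T := by
  refine isClosed_setOfPred_isCompactOperator.closure_subset
    (Metric.mem_closure_iff.2 fun ε hε => ?_)
  obtain ⟨S, hS, hST⟩ := h (ε / 2) (half_pos hε)
  exact ⟨S, hS, by rw [dist_eq_norm]; linarith⟩

theorem isCompactOperator_prodMap {X' Y' : Type*} [NormedAddCommGroup X] [NormedSpace 𝕜 X]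
    [NormedAddCommGroup Y] [NormedSpace 𝕜 Y] [NormedAddCommGroup X'] [NormedSpace 𝕜 X']
    [NormedAddCommGroup Y'] [NormedSpace 𝕜 Y'] {S : X →L[𝕜] Y} {T : X' →L[𝕜] Y'}
    (hS : IsCompactOperator S) (hT : IsCompactOperator T) : IsCompactOperator (S.prodMap T) := by
  have hsum : S.prodMap T =
      ContinuousLinearMap.inl 𝕜 Y Y' ∘L S ∘L ContinuousLinearMap.fst 𝕜 X X' +
        ContinuousLinearMap.inr 𝕜 Y Y' ∘L T ∘L ContinuousLinearMap.snd 𝕜 X X' :=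
    ContinuousLinearMap.ext fun _ => Prod.ext (add_zero _).symm (zero_add _).symm
  rw [hsum]
  have hS' := hS.comp_clm (ContinuousLinearMap.fst 𝕜 X X')
  have hT' := hT.comp_clm (ContinuousLinearMap.snd 𝕜 X X')
  exact (hS'.clm_comp (ContinuousLinearMap.inl 𝕜 Y Y')).add
    (hT'.clm_comp (ContinuousLinearMap.inr 𝕜 Y Y'))

variable [NormedAddCommGroup X] [InnerProductSpace 𝕜 X] [CompleteSpace X]

theorem isCompactOperator_adjoint [NormedAddCommGroup Y] [InnerProductSpace 𝕜 Y] [CompleteSpace Y]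
    {T : X →L[𝕜] Y} (hT : IsCompactOperator T) :
    IsCompactOperator (ContinuousLinearMap.adjoint T) := by
  have hK : IsCompactOperator (T ∘L ContinuousLinearMap.adjoint T) := hT.comp_clm _
  refine isCompactOperator_of_norm_sq_le hK (C := 1) fun y => ?_
  rw [one_mul, ← inner_self_eq_norm_sq (𝕜 := 𝕜), ContinuousLinearMap.adjoint_inner_right]
  exact (RCLike.re_le_norm _).trans (norm_inner_le_norm _ _)

theorem exists_inverse_of_coercive {A : X →L[𝕜] X} {c : ℝ} (hc : 0 < c)
    (hA : ∀ u, c * ‖u‖ ^ 2 ≤ RCLike.re (inner 𝕜 u (A u))) :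
    ∃ S : X →L[𝕜] X, ∀ u f, A u = f ↔ u = S f := by
  obtain ⟨S, rfl⟩ : IsUnit A := by
    refine A.isUnit_of_forall_le_norm_inner_map (c := ⟨c, hc.le⟩) hc fun u => ?_
    rw [norm_inner_symm, mul_comm]
    exact (hA u).trans (RCLike.re_le_norm _)
  let e := ContinuousLinearEquiv.ofUnit S
  exact ⟨e.symm, fun u f => e.toEquiv.eq_symm_apply.symm⟩

/-- The Riesz isomorphism onto the space of continuous conjugate-linear functionals, which maps `x`
to the functional `v ↦ ⟪v, x⟫`. -/
def antidualEquiv (𝕜 X : Type*) [RCLike 𝕜] [NormedAddCommGroup X] [InnerProductSpace 𝕜 X]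
    [CompleteSpace X] : X ≃L[𝕜] (X →L⋆[𝕜] 𝕜) :=
  ContinuousLinearEquiv.ofBijective (innerSLFlip 𝕜)
    (LinearMap.ker_eq_bot.2 fun _ _ h => ext_inner_left 𝕜 fun v => DFunLike.congr_fun h v)
    (LinearMap.range_eq_top.2 fun g => by
      let ℓ : StrongDual 𝕜 X := (starL 𝕜 : 𝕜 ≃L⋆[𝕜] 𝕜).toContinuousLinearMap.comp g
      refine ⟨(InnerProductSpace.toDual 𝕜 X).symm ℓ, ContinuousLinearMap.ext fun v => ?_⟩
      change inner 𝕜 v _ = g v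
      rw [← inner_conj_symm, InnerProductSpace.toDual_symm_apply]
      exact RCLike.conj_conj (g v))

theorem inner_antidualEquiv_symm (g : X →L⋆[𝕜] 𝕜) (v : X) :
    inner 𝕜 v ((antidualEquiv 𝕜 X).symm g) = g v :=
  DFunLike.congr_fun ((antidualEquiv 𝕜 X).apply_symm_apply g) v

theorem exists_rightInverse_of_coercive [NormedAddCommGroup Y] [InnerProductSpace 𝕜 Y]
    [CompleteSpace Y] {J : X →L[𝕜] Y} {M : X →L[𝕜] X} {κ c : ℝ} (hκ : 0 ≤ κ) (hc : 0 < c)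
    (hM : ∀ u, c * ‖u‖ ^ 2 ≤
      RCLike.re (inner 𝕜 u (M u)) + κ * RCLike.re (inner 𝕜 (J u) (J (M u)))) :
    ∃ P : X →L[𝕜] X, ∀ u, M (P u) = u := by
  -- `G` is the Gram operator of `⟪u, v⟫ + κ ⟪J u, J v⟫`, for which `M` is coercive.
  let G : X →L[𝕜] X :=
    ContinuousLinearMap.id 𝕜 X + (κ : 𝕜) • (ContinuousLinearMap.adjoint J ∘L J)
  have hG : ∀ u v, inner 𝕜 u (G v) = inner 𝕜 u v + (κ : 𝕜) * inner 𝕜 (J u) (J v) := fun u v => by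
    rw [← ContinuousLinearMap.adjoint_inner_right, ← inner_smul_right, ← inner_add_right]
    rfl
  have hG_inj : ∀ u, G u = 0 → u = 0 := fun u hu => by
    have hle : ‖u‖ ^ 2 ≤ RCLike.re (inner 𝕜 u (G u)) := by
      rw [hG, map_add, RCLike.re_ofReal_mul, inner_self_eq_norm_sq, inner_self_eq_norm_sq]
      exact le_add_of_nonneg_right (by positivity)
    rw [hu, inner_zero_right, map_zero] at hle
    exact norm_eq_zero.1 (pow_eq_zero_iff two_ne_zero |>.1 (hle.antisymm (by positivity)))
  obtain ⟨S, hS⟩ := exists_inverse_of_coercive (A := G ∘L M) hc fun u => by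
    rw [ContinuousLinearMap.comp_apply, hG, map_add, RCLike.re_ofReal_mul]
    exact hM u
  refine ⟨S ∘L G, fun u => sub_eq_zero.1 (hG_inj _ ?_)⟩
  rw [map_sub, sub_eq_zero]
  exact (hS _ _).2 rfl

theorem isCompactOperator_flip_innerSL [NormedAddCommGroup Y] [InnerProductSpace 𝕜 Y]
    [CompleteSpace Y] {J : X →L[𝕜] Y} (hJ : IsCompactOperator J) :
    IsCompactOperator ((innerSL 𝕜 (E := Y)).comp J).flip := by
  have hfactor : ((innerSL 𝕜 (E := Y)).comp J).flip =
      (antidualEquiv 𝕜 X).toContinuousLinearMap ∘L ContinuousLinearMap.adjoint J := by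
    ext z v
    exact (ContinuousLinearMap.adjoint_inner_right J v z).symm
  rw [hfactor]
  exact (isCompactOperator_adjoint hJ).clm_comp (antidualEquiv 𝕜 X).toContinuousLinearMap

theorem exists_forall_inner_add_inner_eq_iff {Y' : Type*} [NormedAddCommGroup Y]
    [InnerProductSpace 𝕜 Y] [CompleteSpace Y] [NormedAddCommGroup Y'] [InnerProductSpace 𝕜 Y']
    [CompleteSpace Y'] {L : X →L[𝕜] Y} {M : Y →L[𝕜] Y} {K : X →L[𝕜] Y'} {μ C : ℝ}
    (hM : ∀ y, 0 ≤ RCLike.re (inner 𝕜 y (M y))) (hμ : 0 < μ) (hC : 0 < C)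
    (hK : ∀ u, ‖u‖ ^ 2 ≤ C * ‖K u‖ ^ 2) :
    ∃ S : X →L[𝕜] X, ∀ u f,
      (∀ v, inner 𝕜 (L v) (M (L u)) + μ * inner 𝕜 (K v) (K u) = inner 𝕜 v f) ↔ u = S f := by
  let A : X →L[𝕜] X := ContinuousLinearMap.adjoint L ∘L M ∘L L +
    (μ : 𝕜) • (ContinuousLinearMap.adjoint K ∘L K)
  have hA : ∀ u v, inner 𝕜 v (A u) = inner 𝕜 (L v) (M (L u)) + μ * inner 𝕜 (K v) (K u) :=
    fun u v => by
      rw [← ContinuousLinearMap.adjoint_inner_right, ← ContinuousLinearMap.adjoint_inner_right K,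
        ← inner_smul_right, ← inner_add_right]
      rfl
  have hcoercive : ∀ u, μ / C * ‖u‖ ^ 2 ≤ RCLike.re (inner 𝕜 u (A u)) := fun u => by
    rw [hA, map_add, RCLike.re_ofReal_mul, inner_self_eq_norm_sq]
    have hle : μ / C * ‖u‖ ^ 2 ≤ μ * ‖K u‖ ^ 2 := by
      rw [div_mul_eq_mul_div, div_le_iff₀ hC, mul_assoc, mul_comm _ C]
      exact mul_le_mul_of_nonneg_left (hK u) hμ.le
    exact hle.trans (le_add_of_nonneg_left (hM _))
  obtain ⟨S, hS⟩ := exists_inverse_of_coercive (div_pos hμ hC) hcoercive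
  refine ⟨S, fun u f => ?_⟩
  simp only [← hA]
  exact (ext_iff_inner_left 𝕜).symm.trans (hS u f)

theorem exists_inner_eq_sub {X₁ : Type*} [NormedAddCommGroup X₁] [InnerProductSpace 𝕜 X₁]
    [CompleteSpace X₁] [NormedAddCommGroup Y] [InnerProductSpace 𝕜 Y] [CompleteSpace Y]
    (ι : X →L[𝕜] X₁) (D : X₁ →L[𝕜] Y) (P Q : X₁ →L[𝕜] X₁) :
    ∃ R : X₁ × (X₁ →L⋆[𝕜] 𝕜) →L[𝕜] X, ∀ F v, inner 𝕜 v (R F) =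
      inner 𝕜 (D (ι v)) (D (P F.1)) + inner 𝕜 (D (Q (ι v))) (D F.1) - F.2 (Q (ι v)) := by
  let fst := ContinuousLinearMap.fst 𝕜 X₁ (X₁ →L⋆[𝕜] 𝕜)
  let snd := ContinuousLinearMap.snd 𝕜 X₁ (X₁ →L⋆[𝕜] 𝕜)
  let gram := ContinuousLinearMap.adjoint D ∘L D
  refine ⟨ContinuousLinearMap.adjoint ι ∘L (gram ∘L P ∘L fst + ContinuousLinearMap.adjoint Q ∘L
    (gram ∘L fst - (antidualEquiv 𝕜 X₁).symm.toContinuousLinearMap ∘L snd)), fun F v => ?_⟩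
  rw [← inner_antidualEquiv_symm F.2, add_sub_assoc, ← ContinuousLinearMap.adjoint_inner_right D,
    ← ContinuousLinearMap.adjoint_inner_right D, ← inner_sub_right,
    ← ContinuousLinearMap.adjoint_inner_right Q, ← inner_add_right,
    ← ContinuousLinearMap.adjoint_inner_right]
  rfl

end Hilbert

section LpTwo

variable {α F : Type*} [MeasurableSpace α] {ν : Measure α} [NormedAddCommGroup F]

theorem exists_ae_norm_le_of_memLp_top {u : α → F} (hu : MemLp u ∞ ν) :
    ∃ C : ℝ, ∀ᵐ x ∂ν, ‖u x‖ ≤ C := by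
  have hfin : eLpNormEssSup u ν ≠ ∞ := eLpNorm_exponent_top (f := u) ▸ hu.2.ne
  refine ⟨(eLpNormEssSup u ν).toReal, ?_⟩
  filter_upwards [ae_le_eLpNormEssSup (f := u) (μ := ν)] with x hx
  exact toReal_enorm (u x) ▸ ENNReal.toReal_mono hfin hx

theorem sq_lintegral_le {f : α → ℝ≥0∞} (hf : AEMeasurable f ν) :
    (∫⁻ x, f x ∂ν) ^ 2 ≤ ν Set.univ * ∫⁻ x, f x ^ 2 ∂ν := by
  have h := ENNReal.lintegral_mul_le_Lp_mul_Lq ν Real.HolderConjugate.two_two hf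
    (aemeasurable_const (b := (1 : ℝ≥0∞)))
  simp only [Pi.mul_apply, mul_one, lintegral_const, ENNReal.rpow_two, one_pow, one_mul] at h
  calc (∫⁻ x, f x ∂ν) ^ 2
      ≤ ((∫⁻ x, f x ^ 2 ∂ν) ^ (1 / 2 : ℝ) * ν Set.univ ^ (1 / 2 : ℝ)) ^ 2 := by gcongr
    _ = ν Set.univ * ∫⁻ x, f x ^ 2 ∂ν := by
      simp only [mul_pow, ← ENNReal.rpow_two, ← ENNReal.rpow_mul]
      norm_num
      rw [mul_comm]

theorem enorm_sq_eq_lintegral (u : Lp F 2 ν) : ‖u‖ₑ ^ 2 = ∫⁻ x, ‖u x‖ₑ ^ 2 ∂ν := by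
  rw [Lp.enorm_def, eLpNorm_eq_lintegral_rpow_enorm_toReal (by norm_num) (by norm_num),
    ← ENNReal.rpow_two, ← ENNReal.rpow_mul]
  norm_num

theorem inner_eq_integral (u v : Lp ℂ 2 ν) : inner ℂ u v = ∫ x, v x * conj (u x) ∂ν :=
  L2.inner_def u v

/-- Multiplication by a bounded function, as an operator on `L²`. -/
def mulL2 {q : α → ℂ} (hq : MemLp q ∞ ν) : Lp ℂ 2 ν →L[ℂ] Lp ℂ 2 ν :=
  (ContinuousLinearMap.mul ℂ ℂ).holderL ν ∞ 2 2 (hq.toLp q)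

theorem coeFn_mulL2 {q : α → ℂ} (hq : MemLp q ∞ ν) (u : Lp ℂ 2 ν) :
    mulL2 hq u =ᵐ[ν] fun x => q x * u x := by
  filter_upwards [(ContinuousLinearMap.mul ℂ ℂ).coeFn_holder (r := 2) (hq.toLp q) u,
    hq.coeFn_toLp] with x hx hx'
  rw [← hx']
  exact hx

theorem inner_mulL2 {q : α → ℂ} (hq : MemLp q ∞ ν) (u v : Lp ℂ 2 ν) :
    inner ℂ u (mulL2 hq v) = ∫ x, q x * v x * conj (u x) ∂ν := by
  rw [inner_eq_integral]
  refine integral_congr_ae ?_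
  filter_upwards [coeFn_mulL2 hq v] with x hx
  rw [hx]

theorem le_re_inner_mulL2 {q : α → ℂ} (hq : MemLp q ∞ ν) {δ : ℝ} (hδ : ∀ᵐ x ∂ν, δ ≤ (q x).re)
    (u : Lp ℂ 2 ν) : δ * ‖u‖ ^ 2 ≤ (inner ℂ u (mulL2 hq u)).re := by
  have hint : ∀ v : Lp ℂ 2 ν, Integrable (fun x => v x * conj (u x)) ν := fun v =>
    L2.integrable_inner u v
  rw [← inner_self_eq_norm_sq (𝕜 := ℂ), inner_eq_integral, inner_eq_integral,
    ← RCLike.re_to_complex, ← integral_re (hint _), ← integral_re (hint _),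
    ← integral_const_mul]
  refine integral_mono_ae ((hint u).re.const_mul δ) (hint _).re ?_
  filter_upwards [coeFn_mulL2 hq u, hδ] with x hx hδx
  simp only [hx, mul_assoc, Complex.mul_conj, RCLike.re_to_complex, Complex.re_mul_ofReal,
    Complex.ofReal_re]
  exact mul_le_mul_of_nonneg_right hδx (Complex.normSq_nonneg _)

open scoped Topology in
theorem tendsto_mulL2 {q : ℕ → α → ℂ} {r : α → ℂ} (hq : ∀ k, MemLp (q k) ∞ ν) (hr : MemLp r ∞ ν)
    {C : ℝ} (hC : ∀ k, ∀ᵐ x ∂ν, ‖q k x‖ ≤ C)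
    (hlim : ∀ᵐ x ∂ν, Filter.Tendsto (fun k => q k x) Filter.atTop (𝓝 (r x))) (u : Lp ℂ 2 ν) :
    Filter.Tendsto (fun k => mulL2 (hq k) u) Filter.atTop (𝓝 (mulL2 hr u)) := by
  have hrC : ∀ᵐ x ∂ν, ‖r x‖ ≤ C := by
    filter_upwards [hlim, ae_all_iff.2 hC] with x hx hxC
    exact le_of_tendsto hx.norm (.of_forall hxC)
  have hsub : ∀ k, (mulL2 (hq k) u - mulL2 hr u : Lp ℂ 2 ν) =ᵐ[ν]
      fun x => (q k x - r x) * u x := by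
    intro k
    filter_upwards [Lp.coeFn_sub (mulL2 (hq k) u) (mulL2 hr u), coeFn_mulL2 (hq k) u,
      coeFn_mulL2 hr u] with x h1 h2 h3
    rw [h1, Pi.sub_apply, h2, h3, sub_mul]
  have hsq : Filter.Tendsto (fun k => ‖mulL2 (hq k) u - mulL2 hr u‖ₑ ^ 2) Filter.atTop (𝓝 0) := by
    simp only [enorm_sq_eq_lintegral]
    rw [← lintegral_zero (μ := ν)]
    refine tendsto_lintegral_of_dominated_convergence'
      (fun x => ENNReal.ofReal (C + C) ^ 2 * ‖u x‖ₑ ^ 2)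
      (fun k => (Lp.aestronglyMeasurable _).enorm.pow_const 2) (fun k => ?_) ?_ ?_
    · filter_upwards [hsub k, hC k, hrC] with x hx hqx hrx
      rw [hx, enorm_mul, mul_pow, ← ofReal_norm]
      gcongr
      exact (norm_sub_le _ _).trans (add_le_add hqx hrx)
    · rw [lintegral_const_mul' _ _ (by simp), ← enorm_sq_eq_lintegral]
      exact ENNReal.mul_ne_top (by simp) (by simp)
    · filter_upwards [hlim, ae_all_iff.2 hsub] with x hx hsubx
      have h0 := ENNReal.Tendsto.pow (n := 2) (((hx.sub_const (r x)).mul_const (u x)).enorm)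
      simp only [hsubx]
      simpa using h0
  rw [tendsto_iff_norm_sub_tendsto_zero]
  have hsqrt := ((ENNReal.tendsto_toReal ENNReal.zero_ne_top).comp hsq).sqrt
  simpa [Function.comp_def] using hsqrt

end LpTwo

section TestFunctions

theorem test_eq_zero_of_notMem (φ : 𝓓(Ω, ℂ)) {x : E d} (hx : x ∉ Ω) : φ x = 0 :=
  image_eq_zero_of_notMem_tsupport fun h => hx (φ.tsupport_subset h)

theorem differentiable_test (φ : 𝓓(Ω, ℂ)) : Differentiable ℝ φ :=
  φ.contDiff.differentiable (by simp)

theorem coeFn_testL2 (φ : 𝓓(Ω, ℂ)) : testL2 φ =ᵐ[vol Ω] φ := (memLp_test φ).coeFn_toLp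

theorem testL2_add (φ ψ : 𝓓(Ω, ℂ)) : testL2 (φ + ψ) = testL2 φ + testL2 ψ := rfl

theorem testDeriv_add (i : Fin d) (φ ψ : 𝓓(Ω, ℂ)) :
    testDeriv i (φ + ψ) = testDeriv i φ + testDeriv i ψ := by
  ext x
  exact DFunLike.congr_fun
    (fderiv_add (differentiable_test φ x) (differentiable_test ψ x)) (e i)

theorem testDeriv_smul (i : Fin d) (c : ℂ) (φ : 𝓓(Ω, ℂ)) :
    testDeriv i (c • φ) = c • testDeriv i φ := by
  ext x
  exact DFunLike.congr_fun (fderiv_const_smul (differentiable_test φ x) c) (e i)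

/-- The complex conjugate of a test function. -/
def testConj (φ : 𝓓(Ω, ℂ)) : 𝓓(Ω, ℂ) where
  toFun x := conj (φ x)
  contDiff' := Complex.conjCLE.contDiff.comp φ.contDiff
  hasCompactSupport' := φ.hasCompactSupport.comp_left (map_zero _)
  tsupport_subset' := (tsupport_comp_subset (map_zero _) φ).trans φ.tsupport_subset

theorem testDeriv_testConj (i : Fin d) (φ : 𝓓(Ω, ℂ)) :
    testDeriv i (testConj φ) = testConj (testDeriv i φ) := by
  ext x
  exact DFunLike.congr_fun
    (Complex.conjCLE.toContinuousLinearMap.hasFDerivAt.comp x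
      (differentiable_test φ x).hasFDerivAt).fderiv (e i)

theorem inner_testL2 (φ : 𝓓(Ω, ℂ)) (u : L2 Ω) :
    inner ℂ (testL2 φ) u = ∫ x in (Ω : Set (E d)), u x * testConj φ x := by
  rw [inner_eq_integral]
  refine integral_congr_ae ?_
  filter_upwards [coeFn_testL2 φ] with x hx
  rw [hx]
  rfl

theorem inner_testL2_testDeriv (i : Fin d) (φ ψ : 𝓓(Ω, ℂ)) :
    inner ℂ (testL2 (testDeriv i φ)) (testL2 ψ) = -inner ℂ (testL2 φ) (testL2 (testDeriv i ψ)) := by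
  rw [inner_testL2, inner_testL2, ← testDeriv_testConj]
  exact isWeakDeriv_test i ψ (testConj φ)

theorem norm_sq_testDeriv_le (i : Fin d) (φ : 𝓓(Ω, ℂ)) :
    ‖testL2 (testDeriv i φ)‖ ^ 2 ≤ ‖testL2 φ‖ * ‖testL2 (testDeriv i (testDeriv i φ))‖ := by
  rw [← inner_self_eq_norm_sq (𝕜 := ℂ), inner_testL2_testDeriv, ← inner_neg_right]
  exact (RCLike.re_le_norm _).trans ((norm_inner_le_norm _ _).trans_eq (by rw [norm_neg]))

/-- The jet `(φ, ∇φ)` as a linear function of the test function `φ`. -/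
def testJet1L (Ω : Opens (E d)) : 𝓓(Ω, ℂ) →ₗ[ℂ] Jet1 Ω where
  toFun := testJet1
  map_add' φ ψ := by simp only [testJet1, testDeriv_add]; rfl
  map_smul' c φ := by simp only [testJet1, testDeriv_smul]; rfl

/-- The jet `((φ, ∇φ), D²φ)` as a linear function of the test function `φ`. -/
def testJet2L (Ω : Opens (E d)) : 𝓓(Ω, ℂ) →ₗ[ℂ] Jet2 Ω where
  toFun := testJet2
  map_add' φ ψ := by simp only [testJet2, testJet1, testDeriv_add]; rfl
  map_smul' c φ := by simp only [testJet2, testJet1, testDeriv_smul]; rfl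

/-- A test function as an element of `H₀¹(Ω)`. -/
def testH10 (φ : 𝓓(Ω, ℂ)) : H10 Ω :=
  ⟨testJet1 φ, testJet1_mem_H1 φ, subset_closure (Submodule.subset_span ⟨φ, rfl⟩)⟩

/-- A test function as an element of `H₀²(Ω)`. -/
def testH20 (φ : 𝓓(Ω, ℂ)) : H20 Ω :=
  ⟨testJet2 φ, testJet2_mem_H2 φ, subset_closure (Submodule.subset_span ⟨φ, rfl⟩)⟩

theorem denseRange_testH10 : DenseRange (testH10 (Ω := Ω)) := by
  intro u
  have hspan : Submodule.span ℂ (Set.range (testJet1 (Ω := Ω))) = (testJet1L Ω).range :=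
    Submodule.span_eq (testJet1L Ω).range
  have hu : u.1 ∈ (Submodule.span ℂ (Set.range (testJet1 (Ω := Ω)))).topologicalClosure := u.2.2
  rw [hspan] at hu
  rw [closure_subtype, ← Set.range_comp]
  exact hu

theorem denseRange_testH20 : DenseRange (testH20 (Ω := Ω)) := by
  intro u
  have hspan : Submodule.span ℂ (Set.range (testJet2 (Ω := Ω))) = (testJet2L Ω).range :=
    Submodule.span_eq (testJet2L Ω).range
  have hu : u.1 ∈ (Submodule.span ℂ (Set.range (testJet2 (Ω := Ω)))).topologicalClosure := u.2.2
  rw [hspan] at hu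
  rw [closure_subtype, ← Set.range_comp]
  exact hu

end TestFunctions

section SobolevSpaces

/-- The weak gradient on `H₀¹(Ω)`. -/
def H10.grad (Ω : Opens (E d)) : H10 Ω →L[ℂ] PiLp 2 (fun _ : Fin d => L2 Ω) :=
  (WithLp.sndL 2 ℂ (L2 Ω) (PiLp 2 (fun _ : Fin d => L2 Ω))).comp (H10 Ω).subtypeL

/-- The weak Hessian on `H₀²(Ω)`. -/
def H20.hess (Ω : Opens (E d)) : H20 Ω →L[ℂ] PiLp 2 (fun _ : Fin d × Fin d => L2 Ω) :=
  (WithLp.sndL 2 ℂ (Jet1 Ω) (PiLp 2 (fun _ : Fin d × Fin d => L2 Ω))).comp (H20 Ω).subtypeL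

theorem H10.norm_sq_eq (u : H10 Ω) : ‖u‖ ^ 2 = ‖H10.toL2 Ω u‖ ^ 2 + ‖H10.grad Ω u‖ ^ 2 :=
  WithLp.prod_norm_sq_eq_of_L2 u.1

theorem H20.norm_sq_eq (u : H20 Ω) : ‖u‖ ^ 2 = ‖H20.toH10 Ω u‖ ^ 2 + ‖H20.hess Ω u‖ ^ 2 :=
  WithLp.prod_norm_sq_eq_of_L2 u.1

theorem continuous_integral_mul_test (φ : 𝓓(Ω, ℂ)) :
    Continuous fun u : L2 Ω => ∫ x in (Ω : Set (E d)), u x * φ x := by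
  have hφ : φ = testConj (testConj φ) := by
    ext x
    exact (Complex.conj_conj (φ x)).symm
  rw [hφ]
  simp only [← inner_testL2]
  fun_prop

theorem isClosed_isWeakDeriv {X : Type*} [TopologicalSpace X] (i : Fin d) {f g : X → L2 Ω}
    (hf : Continuous f) (hg : Continuous g) : IsClosed {x | IsWeakDeriv Ω i (f x) (g x)} := by
  simp only [IsWeakDeriv, Set.ofPred_forall]
  exact isClosed_iInter fun φ => isClosed_eq ((continuous_integral_mul_test _).comp hf)
    ((continuous_integral_mul_test φ).comp hg).neg

theorem isClosed_H1 : IsClosed (H1 Ω : Set (Jet1 Ω)) := by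
  have h : (H1 Ω : Set (Jet1 Ω)) = ⋂ i, {U | IsWeakDeriv Ω i U.fst (U.snd i)} :=
    Set.ofPred_forall _
  rw [h]
  exact isClosed_iInter fun i => isClosed_isWeakDeriv i (by fun_prop) (by fun_prop)

theorem isClosed_H2 : IsClosed (H2 Ω : Set (Jet2 Ω)) := by
  have h : (H2 Ω : Set (Jet2 Ω)) = (fun U : Jet2 Ω => U.fst) ⁻¹' (H1 Ω : Set (Jet1 Ω)) ∩
      ⋂ i, ⋂ j, {U : Jet2 Ω | IsWeakDeriv Ω j (U.fst.snd i) (U.snd (i, j))} := by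
    ext U
    simp only [Set.mem_inter_iff, Set.mem_iInter]
    rfl
  rw [h]
  exact (isClosed_H1.preimage (by fun_prop)).inter <| isClosed_iInter fun i =>
    isClosed_iInter fun j => isClosed_isWeakDeriv (f := fun U : Jet2 Ω => U.fst.snd i)
      (g := fun U => U.snd (i, j)) j (by fun_prop) (by fun_prop)

theorem isClosed_H10 : IsClosed (H10 Ω : Set (Jet1 Ω)) :=
  isClosed_H1.inter (Submodule.isClosed_topologicalClosure _)

theorem isClosed_H20 : IsClosed (H20 Ω : Set (Jet2 Ω)) :=
  isClosed_H2.inter (Submodule.isClosed_topologicalClosure _)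

instance : CompleteSpace (H10 Ω) := isClosed_H10.completeSpace_coe

instance : CompleteSpace (H20 Ω) := isClosed_H20.completeSpace_coe

theorem eq_zero_of_forall_integral_mul_test {w : L2 Ω}
    (hw : ∀ φ : 𝓓(Ω, ℂ), ∫ x in (Ω : Set (E d)), w x * φ x = 0) : w = 0 := by
  have hae : ∀ᵐ x, x ∈ (Ω : Set (E d)) → w x = 0 := by
    refine Ω.isOpen.ae_eq_zero_of_integral_contDiff_smul_eq_zero
      (locallyIntegrableOn_of_locallyIntegrable_restrict
        ((Lp.memLp w).locallyIntegrable (by norm_num))) fun ψ hψ hψc hψΩ => ?_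
    let φ : 𝓓(Ω, ℂ) :=
      { toFun := fun x => (ψ x : ℂ)
        contDiff' := Complex.ofRealCLM.contDiff.comp hψ
        hasCompactSupport' := hψc.comp_left Complex.ofReal_zero
        tsupport_subset' := (tsupport_comp_subset Complex.ofReal_zero ψ).trans hψΩ }
    rw [← setIntegral_eq_integral_of_forall_compl_eq_zero (s := (Ω : Set (E d))), ← hw φ]
    · refine integral_congr_ae (.of_forall fun x => ?_)
      exact (Complex.real_smul (x := ψ x)).trans (mul_comm _ _)
    · intro x hx
      rw [image_eq_zero_of_notMem_tsupport fun h => hx (hψΩ h), zero_smul]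
  refine Lp.ext ?_
  filter_upwards [(ae_restrict_iff' Ω.isOpen.measurableSet).2 hae, Lp.coeFn_zero ℂ 2 (vol Ω)]
    with x hx hx0
  rw [hx, hx0, Pi.zero_apply]

theorem IsWeakDeriv.unique {i : Fin d} {u : E d → ℂ} {g h : L2 Ω} (hg : IsWeakDeriv Ω i u g)
    (hh : IsWeakDeriv Ω i u h) : g = h := by
  refine sub_eq_zero.1 (eq_zero_of_forall_integral_mul_test fun φ => ?_)
  have hsub : ∀ᵐ x ∂(vol Ω), (g - h : L2 Ω) x * φ x = g x * φ x - h x * φ x := by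
    filter_upwards [Lp.coeFn_sub g h] with x hx
    rw [hx, Pi.sub_apply, sub_mul]
  rw [integral_congr_ae hsub, integral_sub (integrable_mul_test g φ) (integrable_mul_test h φ),
    sub_eq_zero]
  exact neg_injective ((hg φ).symm.trans (hh φ))

theorem H10.toL2_injective : Function.Injective (H10.toL2 Ω) := by
  intro u v (h : u.1.fst = v.1.fst)
  refine Subtype.ext (WithLp.ofLp_injective 2 (Prod.ext h ?_))
  refine WithLp.ofLp_injective 2 (funext fun i => ?_)
  have hu := u.2.1 i
  rw [h] at hu
  exact hu.unique (v.2.1 i)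

end SobolevSpaces

section Translation

variable {V F : Type*} [NormedAddCommGroup V] [NormedSpace ℝ V] [NormedAddCommGroup F]
  [NormedSpace ℝ F] [CompleteSpace F] {f : V → F}

theorem enorm_sub_translate_sq_le (hf : ContDiff ℝ 1 f) (x z : V) :
    ‖f (x + z) - f x‖ₑ ^ 2 ≤ ∫⁻ t in Set.Ioc (0 : ℝ) 1, ‖fderiv ℝ f (x + t • z) z‖ₑ ^ 2 := by
  have hcont : Continuous fun t : ℝ => fderiv ℝ f (x + t • z) z :=
    ((hf.continuous_fderiv one_ne_zero).comp (by fun_prop)).clm_apply continuous_const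
  have hderiv : ∀ t : ℝ, HasDerivAt (fun t : ℝ => f (x + t • z)) (fderiv ℝ f (x + t • z) z) t := by
    intro t
    have hline : HasDerivAt (fun t : ℝ => x + t • z) z t := by
      simpa using ((hasDerivAt_id t).smul_const z).const_add x
    exact ((hf.differentiable one_ne_zero) (x + t • z)).hasFDerivAt.comp_hasDerivAt t hline
  have hFTC : f (x + z) - f x = ∫ t in Set.Ioc (0 : ℝ) 1, fderiv ℝ f (x + t • z) z := by
    rw [← intervalIntegral.integral_of_le zero_le_one,
      intervalIntegral.integral_eq_sub_of_hasDerivAt (fun t _ => hderiv t)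
        (hcont.intervalIntegrable 0 1), one_smul, zero_smul, add_zero]
  calc ‖f (x + z) - f x‖ₑ ^ 2
      ≤ (∫⁻ t in Set.Ioc (0 : ℝ) 1, ‖fderiv ℝ f (x + t • z) z‖ₑ) ^ 2 := by
        rw [hFTC]
        gcongr
        exact enorm_integral_le_lintegral_enorm _
    _ ≤ volume.restrict (Set.Ioc (0 : ℝ) 1) Set.univ *
          ∫⁻ t in Set.Ioc (0 : ℝ) 1, ‖fderiv ℝ f (x + t • z) z‖ₑ ^ 2 :=
        sq_lintegral_le hcont.enorm.aemeasurable
    _ = ∫⁻ t in Set.Ioc (0 : ℝ) 1, ‖fderiv ℝ f (x + t • z) z‖ₑ ^ 2 := by simp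

variable [MeasurableSpace V] [BorelSpace V] {ν : Measure V} [SFinite ν] [ν.IsAddRightInvariant]

theorem lintegral_sub_translate_sq_le (hf : ContDiff ℝ 1 f) (z : V) :
    ∫⁻ x, ‖f (x + z) - f x‖ₑ ^ 2 ∂ν ≤ ∫⁻ x, ‖fderiv ℝ f x z‖ₑ ^ 2 ∂ν := by
  have hcont : Continuous fun p : V × ℝ => fderiv ℝ f (p.1 + p.2 • z) z :=
    ((hf.continuous_fderiv one_ne_zero).comp (by fun_prop)).clm_apply continuous_const
  calc ∫⁻ x, ‖f (x + z) - f x‖ₑ ^ 2 ∂ν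
      ≤ ∫⁻ x, (∫⁻ t in Set.Ioc (0 : ℝ) 1, ‖fderiv ℝ f (x + t • z) z‖ₑ ^ 2) ∂ν :=
        lintegral_mono fun x => enorm_sub_translate_sq_le hf x z
    _ = ∫⁻ t in Set.Ioc (0 : ℝ) 1, (∫⁻ x, ‖fderiv ℝ f (x + t • z) z‖ₑ ^ 2 ∂ν) :=
        lintegral_lintegral_swap (hcont.enorm.measurable.pow_const 2).aemeasurable
    _ = ∫⁻ _t in Set.Ioc (0 : ℝ) 1, (∫⁻ x, ‖fderiv ℝ f x z‖ₑ ^ 2 ∂ν) :=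
        lintegral_congr fun t =>
          lintegral_add_right_eq_self (fun x => ‖fderiv ℝ f x z‖ₑ ^ 2) (t • z)
    _ = ∫⁻ x, ‖fderiv ℝ f x z‖ₑ ^ 2 ∂ν := by simp

theorem lintegral_sq_le_of_translate_disjoint (hf : ContDiff ℝ 1 f) {z : V}
    (hz : ∀ x, f x = 0 ∨ f (x + z) = 0) :
    ∫⁻ x, ‖f x‖ₑ ^ 2 ∂ν ≤ ∫⁻ x, ‖fderiv ℝ f x z‖ₑ ^ 2 ∂ν := by
  refine (lintegral_mono fun x => ?_).trans (lintegral_sub_translate_sq_le hf z)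
  rcases hz x with hx | hx
  · simp only [hx, enorm_zero, ne_eq, OfNat.ofNat_ne_zero, not_false_eq_true, zero_pow, zero_le]
  · rw [hx, zero_sub, enorm_neg]

end Translation

section Poincare

theorem enorm_sq_testL2 (φ : 𝓓(Ω, ℂ)) : ‖testL2 φ‖ₑ ^ 2 = ∫⁻ x, ‖φ x‖ₑ ^ 2 := by
  have hφ : ∀ᵐ x ∂(vol Ω), ‖testL2 φ x‖ₑ ^ 2 = ‖φ x‖ₑ ^ 2 := by
    filter_upwards [coeFn_testL2 φ] with x hx
    rw [hx]
  rw [enorm_sq_eq_lintegral, lintegral_congr_ae hφ]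
  refine setLIntegral_eq_of_support_subset fun x hx => by_contra fun hxΩ => hx ?_
  simp only [test_eq_zero_of_notMem φ hxΩ, enorm_zero, ne_eq, OfNat.ofNat_ne_zero,
    not_false_eq_true, zero_pow]

theorem norm_le_of_enorm_sq_le {F G : Type*} [SeminormedAddGroup F] [SeminormedAddGroup G]
    {u : F} {v : G} {c : ℝ} (hc : 0 ≤ c) (h : ‖u‖ₑ ^ 2 ≤ ENNReal.ofReal c ^ 2 * ‖v‖ₑ ^ 2) :
    ‖u‖ ≤ c * ‖v‖ := by
  rw [← mul_pow, ENNReal.pow_le_pow_left_iff two_ne_zero, ← ofReal_norm, ← ofReal_norm,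
    ← ENNReal.ofReal_mul hc] at h
  exact (ENNReal.ofReal_le_ofReal_iff (by positivity)).1 h

theorem norm_testL2_le {R : ℝ} (hR : 0 ≤ R) (hΩ : ∀ x ∈ Ω, ∀ y ∈ Ω, dist x y < R) (i : Fin d)
    (φ : 𝓓(Ω, ℂ)) : ‖testL2 φ‖ ≤ R * ‖testL2 (testDeriv i φ)‖ := by
  have hdisj : ∀ x, φ x = 0 ∨ φ (x + R • e i) = 0 := by
    intro x
    by_contra! hx
    have hlt := hΩ _ (not_imp_comm.1 (test_eq_zero_of_notMem φ) hx.2) _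
      (not_imp_comm.1 (test_eq_zero_of_notMem φ) hx.1)
    simp [norm_smul, abs_of_nonneg hR] at hlt
  refine norm_le_of_enorm_sq_le hR ?_
  rw [enorm_sq_testL2, enorm_sq_testL2, ← lintegral_const_mul' _ _ (by simp)]
  refine (lintegral_sq_le_of_translate_disjoint (φ.contDiff.of_le (by exact_mod_cast le_top))
    hdisj).trans_eq (lintegral_congr fun x => ?_)
  rw [map_smul, enorm_smul, mul_pow, Real.enorm_of_nonneg hR]
  rfl

theorem exists_norm_sq_le_norm_sq_hess [NeZero d] (hΩ : Bornology.IsBounded (Ω : Set (E d))) :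
    ∃ C > 0, ∀ u : H20 Ω, ‖u‖ ^ 2 ≤ C * ‖H20.hess Ω u‖ ^ 2 := by
  obtain ⟨R, hP⟩ : ∃ R : ℝ, ∀ φ : 𝓓(Ω, ℂ), ‖testL2 φ‖ ≤ R * ‖testL2 (testDeriv 0 φ)‖ :=
    ⟨Metric.diam (Ω : Set (E d)) + 1, norm_testL2_le (by positivity)
      (fun x hx y hy => (Metric.dist_le_diam_of_mem hΩ hx hy).trans_lt (lt_add_one _)) 0⟩
  refine ⟨R ^ 2 * R ^ 2 + R ^ 2 + 1, by positivity, fun u => ?_⟩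
  refine denseRange_testH20.induction_on u
    (p := fun u => ‖u‖ ^ 2 ≤ (R ^ 2 * R ^ 2 + R ^ 2 + 1) * ‖H20.hess Ω u‖ ^ 2)
    (isClosed_le (by fun_prop) (by fun_prop)) fun φ => ?_
  have hgrad : ‖H10.grad Ω (testH10 φ)‖ ^ 2 ≤ R ^ 2 * ‖H20.hess Ω (testH20 φ)‖ ^ 2 := by
    rw [PiLp.norm_sq_eq_of_L2, PiLp.norm_sq_eq_of_L2, Fintype.sum_prod_type, Finset.mul_sum]
    refine Finset.sum_le_sum fun i _ => ?_
    calc ‖testL2 (testDeriv i φ)‖ ^ 2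
        ≤ R ^ 2 * ‖testL2 (testDeriv 0 (testDeriv i φ))‖ ^ 2 := by
          rw [← mul_pow]
          gcongr
          exact hP _
      _ ≤ R ^ 2 * ∑ j, ‖testL2 (testDeriv j (testDeriv i φ))‖ ^ 2 := by
          gcongr
          exact Finset.single_le_sum (f := fun j => ‖testL2 (testDeriv j (testDeriv i φ))‖ ^ 2)
            (fun j _ => by positivity) (Finset.mem_univ 0)
  have hφ : ‖testL2 φ‖ ^ 2 ≤ R ^ 2 * ‖H10.grad Ω (testH10 φ)‖ ^ 2 := by
    calc ‖testL2 φ‖ ^ 2 ≤ (R * ‖testL2 (testDeriv 0 φ)‖) ^ 2 := by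
          gcongr
          exact hP φ
      _ ≤ R ^ 2 * ‖H10.grad Ω (testH10 φ)‖ ^ 2 := by
          rw [mul_pow]
          gcongr
          exact PiLp.norm_apply_le (H10.grad Ω (testH10 φ)) 0
  calc ‖testH20 φ‖ ^ 2
      = ‖testL2 φ‖ ^ 2 + ‖H10.grad Ω (testH10 φ)‖ ^ 2 + ‖H20.hess Ω (testH20 φ)‖ ^ 2 := by
        rw [H20.norm_sq_eq]
        congr 1
        exact H10.norm_sq_eq (testH10 φ)
    _ ≤ (R ^ 2 * R ^ 2 + R ^ 2 + 1) * ‖H20.hess Ω (testH20 φ)‖ ^ 2 := by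
        linarith [mul_le_mul_of_nonneg_left hgrad (sq_nonneg R)]

end Poincare

section Average

variable {α F : Type*} [NormedAddCommGroup F] [NormedSpace ℝ F] [CompleteSpace F]

theorem enorm_integral_sub_sq_le [MeasurableSpace α] {P : Measure α} [IsProbabilityMeasure P]
    {f : α → F} (hf : Integrable f P) (c : F) :
    ‖∫ y, f y ∂P - c‖ₑ ^ 2 ≤ ∫⁻ y, ‖f y - c‖ₑ ^ 2 ∂P := by
  have hfc : Integrable (fun y => f y - c) P := hf.sub (integrable_const c)
  calc ‖∫ y, f y ∂P - c‖ₑ ^ 2 = ‖∫ y, (f y - c) ∂P‖ₑ ^ 2 := by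
        rw [integral_sub hf (integrable_const c), integral_const, probReal_univ, one_smul]
    _ ≤ (∫⁻ y, ‖f y - c‖ₑ ∂P) ^ 2 := by
        gcongr
        exact enorm_integral_le_lintegral_enorm _
    _ ≤ ∫⁻ y, ‖f y - c‖ₑ ^ 2 ∂P := by
        simpa only [measure_univ, one_mul] using sq_lintegral_le hfc.aestronglyMeasurable.enorm

theorem enorm_setAverage_sub_sq_le [AddGroup α] [MeasurableSpace α] [MeasurableAdd α]
    {ν : Measure α} [ν.IsAddLeftInvariant] {s B : Set α} (hs : MeasurableSet s)
    (hB : MeasurableSet B) (hs0 : ν s ≠ 0) (hs1 : ν s ≠ ∞) {f : α → F} (hf : IntegrableOn f s ν)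
    {x : α} (hsB : ∀ z, x + z ∈ s → z ∈ B) :
    ‖⨍ y in s, f y ∂ν - f x‖ₑ ^ 2 ≤ (ν s)⁻¹ * ∫⁻ z in B, ‖f (x + z) - f x‖ₑ ^ 2 ∂ν := by
  have hP : IsProbabilityMeasure ((ν s)⁻¹ • ν.restrict s) :=
    ⟨by simp [ENNReal.inv_mul_cancel hs0 hs1]⟩
  have hfP : Integrable f ((ν s)⁻¹ • ν.restrict s) :=
    Integrable.smul_measure hf (ENNReal.inv_ne_top.2 hs0)
  calc ‖⨍ y in s, f y ∂ν - f x‖ₑ ^ 2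
      ≤ ∫⁻ y, ‖f y - f x‖ₑ ^ 2 ∂((ν s)⁻¹ • ν.restrict s) := by
        rw [average, Measure.restrict_apply_univ]
        exact enorm_integral_sub_sq_le hfP (f x)
    _ = (ν s)⁻¹ * ∫⁻ z, s.indicator (fun y => ‖f y - f x‖ₑ ^ 2) (x + z) ∂ν := by
        rw [lintegral_smul_measure, lintegral_add_left_eq_self, lintegral_indicator hs, smul_eq_mul]
    _ ≤ (ν s)⁻¹ * ∫⁻ z in B, ‖f (x + z) - f x‖ₑ ^ 2 ∂ν := by
        rw [← lintegral_indicator hB]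
        gcongr with z
        refine Set.indicator_apply_le' (fun hz => ?_) fun _ => zero_le
        rw [Set.indicator_of_mem (hsB z hz)]

end Average

section Grid

/-- The cell with index `k` of the cubic grid of mesh size `h`. -/
def gridCell (h : ℝ) (k : Fin d → ℤ) : Set (E d) := {x | ∀ i, ⌊x i / h⌋ = k i}

/-- The cube `[-h, h]ᵈ`, which contains the differences of points in a grid cell of size `h`. -/
def cube (d : ℕ) (h : ℝ) : Set (E d) := {z | ∀ i, z i ∈ Set.Icc (-h) h}

theorem measurableSet_setOf_forall_mem {s : Fin d → Set ℝ} (hs : ∀ i, MeasurableSet (s i)) :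
    MeasurableSet {x : E d | ∀ i, x i ∈ s i} := by
  simp only [Set.ofPred_forall]
  exact MeasurableSet.iInter fun i => (hs i).preimage (f := fun x : E d => x i) (by fun_prop)

theorem volume_setOf_forall_mem {s : Fin d → Set ℝ} (hs : ∀ i, MeasurableSet (s i)) :
    volume {x : E d | ∀ i, x i ∈ s i} = ∏ i, volume (s i) := by
  have h := (PiLp.volume_preserving_ofLp (Fin d)).measure_preimage
    (MeasurableSet.univ_pi hs).nullMeasurableSet
  rw [volume_pi_pi] at h
  rw [← h]
  congr 1
  ext x
  exact Set.mem_univ_pi.symm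

variable {h : ℝ}

theorem measurableSet_cube : MeasurableSet (cube d h) :=
  measurableSet_setOf_forall_mem fun _ => measurableSet_Icc

theorem volume_cube : volume (cube d h) = (2 * ENNReal.ofReal h) ^ d := by
  rw [cube, volume_setOf_forall_mem fun _ => measurableSet_Icc]
  have hh : h - -h = 2 * h := by ring
  simp only [Real.volume_Icc, hh, ENNReal.ofReal_mul zero_le_two, ENNReal.ofReal_ofNat,
    Finset.prod_const, Finset.card_univ, Fintype.card_fin]

variable (hh : 0 < h)
include hh

theorem gridCell_eq (k : Fin d → ℤ) :
    gridCell h k = {x : E d | ∀ i, x i ∈ Set.Ico (k i * h) ((k i + 1) * h)} := by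
  ext x
  refine forall_congr' fun i => ?_
  rw [Int.floor_eq_iff, le_div_iff₀ hh, div_lt_iff₀ hh]
  rfl

theorem measurableSet_gridCell (k : Fin d → ℤ) : MeasurableSet (gridCell h k) := by
  rw [gridCell_eq hh]
  exact measurableSet_setOf_forall_mem fun _ => measurableSet_Ico

theorem volume_gridCell (k : Fin d → ℤ) : volume (gridCell h k) = ENNReal.ofReal h ^ d := by
  rw [gridCell_eq hh, volume_setOf_forall_mem fun i => measurableSet_Ico]
  simp [add_mul]

theorem mem_cube_of_mem_gridCell {k : Fin d → ℤ} {x z : E d} (hx : x ∈ gridCell h k)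
    (hz : x + z ∈ gridCell h k) : z ∈ cube d h := by
  intro i
  have habs := abs_lt.1 (Int.abs_sub_lt_one_of_floor_eq_floor ((hz i).trans (hx i).symm))
  rw [← sub_div, PiLp.add_apply, add_sub_cancel_left, lt_div_iff₀ hh, div_lt_iff₀ hh] at habs
  constructor <;> linarith

theorem exists_finset_gridCell {s : Set (E d)} (hs : Bornology.IsBounded s) :
    ∃ K : Finset (Fin d → ℤ), ∀ x ∈ s, ∃ k ∈ K, x ∈ gridCell h k := by
  obtain ⟨R, hR⟩ := hs.exists_norm_le
  refine ⟨Fintype.piFinset fun _ => Finset.Icc ⌊-R / h⌋ ⌊R / h⌋, fun x hx => ?_⟩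
  refine ⟨fun i => ⌊x i / h⌋, Fintype.mem_piFinset.2 fun i => Finset.mem_Icc.2 ?_, fun _ => rfl⟩
  have hxi := abs_le.1 ((PiLp.norm_apply_le x i).trans (hR x hx))
  exact ⟨Int.floor_le_floor (by gcongr; exact hxi.1), Int.floor_le_floor (by gcongr; exact hxi.2)⟩

theorem volume_gridCell_restrict_ne_top (k : Fin d → ℤ) : vol Ω (gridCell h k) ≠ ∞ :=
  ((Measure.restrict_apply_le _ _).trans_lt (by simp [volume_gridCell hh])).ne

end Grid

section Rellich

variable {h : ℝ} (hh : 0 < h) (K : Finset (Fin d → ℤ))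

/-- The finite rank operator that replaces `u` by its mean value on each grid cell with index
in `K` (where `u` is extended by zero outside `Ω`) and by `0` elsewhere. -/
def gridAverage (Ω : Opens (E d)) : L2 Ω →L[ℂ] L2 Ω :=
  let χ k : L2 Ω :=
    indicatorConstLp 2 (measurableSet_gridCell hh k) (volume_gridCell_restrict_ne_top hh k) 1
  ∑ k ∈ K, ((volume.real (gridCell h k))⁻¹ : ℝ) • (innerSL ℂ (χ k)).smulRight (χ k)

theorem isCompactOperator_gridAverage : IsCompactOperator (gridAverage hh K Ω) := by
  refine Submodule.sum_mem (compactOperator (RingHom.id ℂ) (L2 Ω) (L2 Ω)) fun k _ => ?_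
  exact ((isCompactOperator_of_locallyCompactSpace_rng
    (ContinuousLinearMap.toSpanSingleton ℂ (_ : L2 Ω))).comp_clm (innerSL ℂ (_ : L2 Ω))).smul
      ((volume.real (gridCell h k))⁻¹ : ℝ)

theorem inner_indicatorConstLp_testL2 {s : Set (E d)} (hs : MeasurableSet s)
    (hsΩ : vol Ω s ≠ ∞) (φ : 𝓓(Ω, ℂ)) :
    inner ℂ (indicatorConstLp 2 hs hsΩ 1) (testL2 φ) = ∫ y in s, φ y := by
  rw [L2.inner_indicatorConstLp_one, integral_congr_ae (ae_restrict_of_ae (coeFn_testL2 φ)),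
    Measure.restrict_restrict hs]
  exact (setIntegral_eq_of_subset_of_forall_sdiff_eq_zero hs Set.inter_subset_left
    fun x hx => test_eq_zero_of_notMem φ fun hxΩ => hx.2 ⟨hx.1, hxΩ⟩).symm

theorem coeFn_gridAverage_testL2 (φ : 𝓓(Ω, ℂ)) :
    ∀ᵐ x ∂(vol Ω), ∀ k ∈ K, x ∈ gridCell h k →
      gridAverage hh K Ω (testL2 φ) x = ⨍ y in gridCell h k, φ y := by
  let χ k : L2 Ω :=
    indicatorConstLp 2 (measurableSet_gridCell hh k) (volume_gridCell_restrict_ne_top hh k) 1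
  have hsum : gridAverage hh K Ω (testL2 φ) = ∑ k ∈ K, (⨍ y in gridCell h k, φ y) • χ k := by
    rw [gridAverage, _root_.sum_apply]
    refine Finset.sum_congr rfl fun k _ => ?_
    rw [setAverage_eq, ← inner_indicatorConstLp_testL2 (measurableSet_gridCell hh k)
      (volume_gridCell_restrict_ne_top hh k), smul_assoc]
    rfl
  have hχ : ∀ᵐ x ∂(vol Ω), ∀ k, χ k x = (gridCell h k).indicator (fun _ => (1 : ℂ)) x :=
    ae_all_iff.2 fun k => indicatorConstLp_coeFn
  have hsmul : ∀ᵐ x ∂(vol Ω), ∀ k, ((⨍ y in gridCell h k, φ y) • χ k : L2 Ω) x =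
      (⨍ y in gridCell h k, φ y) * χ k x := ae_all_iff.2 fun k => Lp.coeFn_smul _ _
  rw [hsum]
  filter_upwards [hχ, hsmul, Lp.coeFn_fun_finsetSum K fun k => (⨍ y in gridCell h k, φ y) • χ k]
    with x hχx hsmulx hsumx k hk hxk
  rw [hsumx, Finset.sum_eq_single_of_mem k hk, hsmulx, hχx, Set.indicator_of_mem hxk, mul_one]
  intro l _ hlk
  rw [hsmulx, hχx, Set.indicator_of_notMem, mul_zero]
  exact fun hxl => hlk (funext fun i => (hxl i).symm.trans (hxk i))

variable {K}

theorem enorm_sub_gridAverage_testL2_sq_le (hK : ∀ x ∈ Ω, ∃ k ∈ K, x ∈ gridCell h k)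
    (φ : 𝓓(Ω, ℂ)) :
    ‖testL2 φ - gridAverage hh K Ω (testL2 φ)‖ₑ ^ 2 ≤
      (ENNReal.ofReal h ^ d)⁻¹ * ∫⁻ z in cube d h, ∫⁻ x, ‖φ (x + z) - φ x‖ₑ ^ 2 := by
  have hpt : ∀ᵐ x ∂(vol Ω), ‖(testL2 φ - gridAverage hh K Ω (testL2 φ) : L2 Ω) x‖ₑ ^ 2 ≤
      (ENNReal.ofReal h ^ d)⁻¹ * ∫⁻ z in cube d h, ‖φ (x + z) - φ x‖ₑ ^ 2 := by
    filter_upwards [coeFn_testL2 φ, coeFn_gridAverage_testL2 hh K φ,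
      Lp.coeFn_sub (testL2 φ) (gridAverage hh K Ω (testL2 φ)),
      ae_restrict_mem Ω.isOpen.measurableSet] with x hφ havg hsub hx
    obtain ⟨k, hk, hxk⟩ := hK x hx
    rw [hsub, Pi.sub_apply, hφ, havg k hk hxk, enorm_sub_rev, ← volume_gridCell hh k]
    exact enorm_setAverage_sub_sq_le (measurableSet_gridCell hh k) measurableSet_cube
      (by simp [volume_gridCell hh, hh]) (by simp [volume_gridCell hh])
      (φ.continuous.integrable_of_hasCompactSupport φ.hasCompactSupport).integrableOn
      fun z hz => mem_cube_of_mem_gridCell hh hxk hz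
  have hcont : Continuous fun p : E d × E d => φ (p.1 + p.2) - φ p.1 := by fun_prop
  rw [enorm_sq_eq_lintegral, ← lintegral_lintegral_swap
    (hcont.enorm.measurable.pow_const 2).aemeasurable, ← lintegral_const_mul' _ _ (by simp [hh])]
  exact (lintegral_mono_ae hpt).trans (setLIntegral_le_lintegral _ _)

omit hh in
theorem lintegral_sub_translate_test_sq_le {z : E d} (hz : z ∈ cube d h) (φ : 𝓓(Ω, ℂ)) :
    ∫⁻ x, ‖φ (x + z) - φ x‖ₑ ^ 2 ≤
      ENNReal.ofReal h ^ 2 * (d * ‖H10.grad Ω (testH10 φ)‖ₑ ^ 2) := by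
  have hderiv : ∀ x, fderiv ℝ φ x z = ∑ i, z i • testDeriv i φ x := by
    intro x
    conv_lhs => rw [← (EuclideanSpace.basisFun (Fin d) ℝ).sum_repr z, map_sum]
    simp only [map_smul, EuclideanSpace.basisFun_apply]
    rfl
  have hpt : ∀ x, ‖fderiv ℝ φ x z‖ₑ ^ 2 ≤
      ENNReal.ofReal h ^ 2 * (d * ∑ i, ‖testDeriv i φ x‖ₑ ^ 2) := by
    intro x
    calc ‖fderiv ℝ φ x z‖ₑ ^ 2 ≤ (∑ i, ENNReal.ofReal h * ‖testDeriv i φ x‖ₑ) ^ 2 := by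
          rw [hderiv]
          gcongr
          refine (enorm_sum_le _ _).trans (Finset.sum_le_sum fun i _ => ?_)
          rw [enorm_smul, ← ofReal_norm (z i)]
          gcongr
          exact abs_le.2 (hz i)
      _ = ENNReal.ofReal h ^ 2 * (∑ i, ‖testDeriv i φ x‖ₑ) ^ 2 := by
          rw [← Finset.mul_sum, mul_pow]
      _ ≤ ENNReal.ofReal h ^ 2 * (d * ∑ i, ‖testDeriv i φ x‖ₑ ^ 2) := by
          gcongr
          simpa [lintegral_count, tsum_fintype] using sq_lintegral_le (ν := Measure.count)
            (f := fun i : Fin d => ‖testDeriv i φ x‖ₑ) (measurable_of_finite _).aemeasurable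
  have hgrad : ‖H10.grad Ω (testH10 φ)‖ₑ ^ 2 = ∑ i, ‖testL2 (testDeriv i φ)‖ₑ ^ 2 := by
    simp only [← ofReal_norm, ← ENNReal.ofReal_pow (norm_nonneg _), PiLp.norm_sq_eq_of_L2]
    exact ENNReal.ofReal_sum_of_nonneg fun i _ => by positivity
  refine ((lintegral_sub_translate_sq_le (φ.contDiff.of_le (by exact_mod_cast le_top)) z).trans
    (lintegral_mono hpt)).trans_eq ?_
  rw [lintegral_const_mul' _ _ (by simp), lintegral_const_mul' _ _ (by simp), lintegral_finsetSum
    _ fun i _ => (testDeriv i φ).continuous.enorm.measurable.pow_const 2, hgrad]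
  simp only [enorm_sq_testL2]

theorem norm_sub_gridAverage_testL2_le (hK : ∀ x ∈ Ω, ∃ k ∈ K, x ∈ gridCell h k) (φ : 𝓓(Ω, ℂ)) :
    ‖testL2 φ - gridAverage hh K Ω (testL2 φ)‖ ≤
      √(2 ^ d * d) * h * ‖H10.grad Ω (testH10 φ)‖ := by
  have hc : ENNReal.ofReal (√(2 ^ d * d) * h) ^ 2 = 2 ^ d * d * ENNReal.ofReal h ^ 2 := by
    rw [ENNReal.ofReal_mul (by positivity), mul_pow, ← ENNReal.ofReal_pow (by positivity),
      Real.sq_sqrt (by positivity), ENNReal.ofReal_mul (by positivity),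
      ENNReal.ofReal_pow zero_le_two, ENNReal.ofReal_natCast, ENNReal.ofReal_ofNat]
  refine norm_le_of_enorm_sq_le (by positivity) ?_
  calc ‖testL2 φ - gridAverage hh K Ω (testL2 φ)‖ₑ ^ 2
      ≤ (ENNReal.ofReal h ^ d)⁻¹ * ∫⁻ z in cube d h, ∫⁻ x, ‖φ (x + z) - φ x‖ₑ ^ 2 :=
        enorm_sub_gridAverage_testL2_sq_le hh hK φ
    _ ≤ (ENNReal.ofReal h ^ d)⁻¹ * ∫⁻ _z in cube d h,
          ENNReal.ofReal h ^ 2 * (d * ‖H10.grad Ω (testH10 φ)‖ₑ ^ 2) := by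
        gcongr 1
        exact setLIntegral_mono measurable_const fun z hz =>
          lintegral_sub_translate_test_sq_le hz φ
    _ = ((ENNReal.ofReal h ^ d)⁻¹ * ENNReal.ofReal h ^ d) *
          (2 ^ d * d * ENNReal.ofReal h ^ 2 * ‖H10.grad Ω (testH10 φ)‖ₑ ^ 2) := by
        rw [setLIntegral_const, volume_cube]
        ring
    _ = ENNReal.ofReal (√(2 ^ d * d) * h) ^ 2 * ‖H10.grad Ω (testH10 φ)‖ₑ ^ 2 := by
        rw [ENNReal.inv_mul_cancel (by simp [hh]) (by simp), one_mul, hc]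

theorem isCompactOperator_toL2 (hΩ : Bornology.IsBounded (Ω : Set (E d))) :
    IsCompactOperator (H10.toL2 Ω) := by
  refine isCompactOperator_of_forall_norm_sub_le fun ε hε => ?_
  obtain ⟨h, hh, hhε⟩ : ∃ h > 0, √(2 ^ d * d) * h ≤ ε := by
    refine ⟨ε / (√(2 ^ d * d) + 1), by positivity, ?_⟩
    rw [← mul_div_assoc, div_le_iff₀ (by positivity)]
    linarith
  obtain ⟨K, hK⟩ := exists_finset_gridCell hh hΩ
  refine ⟨gridAverage hh K Ω ∘L H10.toL2 Ω, (isCompactOperator_gridAverage hh K).comp_clm _,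
    ContinuousLinearMap.opNorm_le_bound _ hε.le fun u => ?_⟩
  refine denseRange_testH10.induction_on u
    (p := fun u => ‖(H10.toL2 Ω - gridAverage hh K Ω ∘L H10.toL2 Ω) u‖ ≤ ε * ‖u‖)
    (isClosed_le (by fun_prop) (by fun_prop)) fun φ => ?_
  calc ‖testL2 φ - gridAverage hh K Ω (testL2 φ)‖
      ≤ √(2 ^ d * d) * h * ‖H10.grad Ω (testH10 φ)‖ := norm_sub_gridAverage_testL2_le hh hK φ
    _ ≤ ε * ‖testH10 φ‖ := by
        gcongr
        exact WithLp.norm_snd_le _ (testJet1 φ)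

end Rellich

section CompactEmbeddings

theorem norm_sq_toH10_le (u : H20 Ω) :
    ‖H20.toH10 Ω u‖ ^ 2 ≤ (1 + d) * (‖H10.toL2 Ω (H20.toH10 Ω u)‖ * ‖u‖) := by
  refine denseRange_testH20.induction_on u
    (p := fun u => ‖H20.toH10 Ω u‖ ^ 2 ≤ (1 + d) * (‖H10.toL2 Ω (H20.toH10 Ω u)‖ * ‖u‖))
    (isClosed_le (by fun_prop) (by fun_prop)) fun φ => ?_
  have hfst : ‖testL2 φ‖ ≤ ‖testH20 φ‖ :=
    (WithLp.norm_fst_le _ (testJet1 φ)).trans (WithLp.norm_fst_le _ (testJet2 φ))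
  have hhess : ∀ i, ‖testL2 (testDeriv i (testDeriv i φ))‖ ≤ ‖testH20 φ‖ := fun i =>
    (PiLp.norm_apply_le (H20.hess Ω (testH20 φ)) (i, i)).trans (WithLp.norm_snd_le _ (testJet2 φ))
  calc ‖testH10 φ‖ ^ 2 = ‖testL2 φ‖ ^ 2 + ∑ i, ‖testL2 (testDeriv i φ)‖ ^ 2 := by
        rw [H10.norm_sq_eq, PiLp.norm_sq_eq_of_L2]
        rfl
    _ ≤ ‖testL2 φ‖ * ‖testH20 φ‖ + ∑ _i : Fin d, ‖testL2 φ‖ * ‖testH20 φ‖ := by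
        rw [sq]
        gcongr with i
        exact (norm_sq_testDeriv_le i φ).trans (by gcongr; exact hhess i)
    _ = (1 + d) * (‖testL2 φ‖ * ‖testH20 φ‖) := by
        rw [Finset.sum_const, Finset.card_univ, Fintype.card_fin, nsmul_eq_mul]
        ring

variable (hΩ : Bornology.IsBounded (Ω : Set (E d)))
include hΩ

theorem isCompactOperator_toH10 : IsCompactOperator (H20.toH10 Ω) :=
  isCompactOperator_of_norm_sq_le (K := H10.toL2 Ω ∘L H20.toH10 Ω)
    ((isCompactOperator_toL2 hΩ).comp_clm _) norm_sq_toH10_le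

theorem isCompactOperator_L2toHneg1 : IsCompactOperator (L2toHneg1 Ω) := by
  have hflip := isCompactOperator_flip_innerSL (𝕜 := ℂ) (X := H10 Ω) (Y := L2 Ω)
    (isCompactOperator_toL2 hΩ)
  exact hflip

theorem isCompactOperator_incl : IsCompactOperator (incl Ω) := by
  have hprod := isCompactOperator_prodMap (𝕜 := ℂ) (X := H20 Ω) (Y := H10 Ω) (X' := L2 Ω)
    (Y' := Hneg1 Ω) (isCompactOperator_toH10 hΩ) (isCompactOperator_L2toHneg1 hΩ)
  exact hprod

end CompactEmbeddings

section Mollification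

open ContinuousLinearMap (lsmul)
open scoped Convolution Topology

/-- The mollification of the extension of `u` by zero outside `Ω`. -/
def mollify (Ω : Opens (E d)) (b : ContDiffBump (0 : E d)) (u : E d → ℂ) : E d → ℂ :=
  b.normed volume ⋆[lsmul ℝ ℝ, volume] (Ω : Set (E d)).indicator u

theorem contDiff_normed (b : ContDiffBump (0 : E d)) :
    ContDiff ℝ ((⊤ : ℕ∞) : WithTop ℕ∞) (b.normed volume) :=
  b.contDiff_normed

theorem memLp_indicator {u : E d → ℂ} (hu : MemLp u ∞ (vol Ω)) :
    MemLp ((Ω : Set (E d)).indicator u) ∞ volume :=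
  (memLp_indicator_iff_restrict Ω.isOpen.measurableSet).2 hu

theorem locallyIntegrable_indicator {u : E d → ℂ} (hu : MemLp u ∞ (vol Ω)) :
    LocallyIntegrable ((Ω : Set (E d)).indicator u) volume :=
  (memLp_indicator hu).locallyIntegrable (by simp)

theorem contDiff_mollify (b : ContDiffBump (0 : E d)) {u : E d → ℂ} (hu : MemLp u ∞ (vol Ω)) :
    ContDiff ℝ ((⊤ : ℕ∞) : WithTop ℕ∞) (mollify Ω b u) :=
  b.hasCompactSupport_normed.contDiff_convolution_left _ (contDiff_normed b)
    (locallyIntegrable_indicator hu)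

theorem norm_mollify_le (b : ContDiffBump (0 : E d)) {u : E d → ℂ} {C : ℝ}
    (hC : ∀ᵐ x, ‖(Ω : Set (E d)).indicator u x‖ ≤ C) (x : E d) : ‖mollify Ω b u x‖ ≤ C := by
  have hae : ∀ᵐ t, ‖(Ω : Set (E d)).indicator u (x - t)‖ ≤ C :=
    (quasiMeasurePreserving_sub_left volume x).ae hC
  calc ‖mollify Ω b u x‖ ≤ ∫ t, b.normed volume t * C := by
        refine norm_integral_le_of_norm_le (b.integrable_normed.mul_const C) ?_
        filter_upwards [hae] with t ht
        rw [ContinuousLinearMap.lsmul_apply, norm_smul, Real.norm_of_nonneg (b.nonneg_normed t)]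
        exact mul_le_mul_of_nonneg_left ht (b.nonneg_normed t)
    _ = C := by rw [integral_mul_const, b.integral_normed, one_mul]

theorem integral_smul_indicator (c : E d → ℝ) (u : E d → ℂ) :
    ∫ t, c t • (Ω : Set (E d)).indicator u t = ∫ t in (Ω : Set (E d)), u t * (c t : ℂ) := by
  simp only [← Set.indicator_smul_apply, Complex.real_smul, mul_comm (c _ : ℂ)]
  exact integral_indicator Ω.isOpen.measurableSet

theorem mollify_apply (b : ContDiffBump (0 : E d)) (u : E d → ℂ) (x : E d) :
    mollify Ω b u x = ∫ t in (Ω : Set (E d)), u t * (b.normed volume (x - t) : ℂ) := by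
  rw [mollify, convolution_lsmul_swap, integral_smul_indicator]

theorem fderiv_mollify_apply (b : ContDiffBump (0 : E d)) {u : E d → ℂ} (hu : MemLp u ∞ (vol Ω))
    (x v : E d) : fderiv ℝ (mollify Ω b u) x v =
      ∫ t in (Ω : Set (E d)), u t * (fderiv ℝ (b.normed volume) (x - t) v : ℂ) := by
  have hf := contDiff_normed b
  have hloc := locallyIntegrable_indicator hu
  have hderiv := b.hasCompactSupport_normed.hasFDerivAt_convolution_left (μ := volume)
    (lsmul ℝ ℝ : ℝ →L[ℝ] ℂ →L[ℝ] ℂ) (hf.of_le (by exact_mod_cast le_top)) hloc x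
  have hexists := (b.hasCompactSupport_normed.fderiv ℝ).convolutionExists_left (μ := volume)
    ((lsmul ℝ ℝ : ℝ →L[ℝ] ℂ →L[ℝ] ℂ).precompL (E d)) (hf.continuous_fderiv (by simp)) hloc x
  rw [mollify, hderiv.fderiv, convolution_def, ContinuousLinearMap.integral_apply hexists,
    ← integral_smul_indicator]
  exact convolution_lsmul_swap (f := fun t => fderiv ℝ (b.normed volume) t v)

theorem normed_sub_eq_zero (b : ContDiffBump (0 : E d)) {x t : E d}
    (ht : t ∉ Metric.closedBall x b.rOut) : b.normed volume (x - t) = 0 := by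
  rw [← Function.notMem_support, b.support_normed_eq, Metric.mem_ball, dist_zero_right,
    ← dist_eq_norm, dist_comm]
  exact fun h => ht h.le

/-- The mollification kernel `t ↦ b (x - t)` as a test function. -/
def kernelTest (b : ContDiffBump (0 : E d)) (x : E d) (hx : Metric.closedBall x b.rOut ⊆ Ω) :
    𝓓(Ω, ℂ) where
  toFun t := (b.normed volume (x - t) : ℂ)
  contDiff' := Complex.ofRealCLM.contDiff.comp
    ((contDiff_normed b).comp (contDiff_const.sub contDiff_id))
  hasCompactSupport' := HasCompactSupport.intro (isCompact_closedBall x b.rOut) fun t ht => by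
    rw [normed_sub_eq_zero b ht, Complex.ofReal_zero]
  tsupport_subset' := by
    refine (closure_minimal (fun t ht => ?_) Metric.isClosed_closedBall).trans hx
    by_contra h
    exact ht (congrArg _ (normed_sub_eq_zero b h))

theorem testDeriv_kernelTest {b : ContDiffBump (0 : E d)} {x : E d}
    (hx : Metric.closedBall x b.rOut ⊆ Ω) (i : Fin d) (t : E d) :
    testDeriv i (kernelTest b x hx) t = -(fderiv ℝ (b.normed volume) (x - t) (e i) : ℂ) := by
  have hsub : HasFDerivAt (fun t => x - t) (-ContinuousLinearMap.id ℝ (E d)) t :=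
    (hasFDerivAt_id t).const_sub x
  have hderiv := Complex.ofRealCLM.hasFDerivAt.comp t
    ((((contDiff_normed b).differentiable (by simp)) (x - t)).hasFDerivAt.comp t hsub)
  calc testDeriv i (kernelTest b x hx) t = _ := DFunLike.congr_fun hderiv.fderiv (e i)
    _ = _ := by simp

theorem fderiv_mollify {b : ContDiffBump (0 : E d)} {i : Fin d} {u g : E d → ℂ}
    (hu : MemLp u ∞ (vol Ω)) (hg : IsWeakDeriv Ω i u g) {x : E d}
    (hx : Metric.closedBall x b.rOut ⊆ Ω) :
    fderiv ℝ (mollify Ω b u) x (e i) = mollify Ω b g x := by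
  have hweak := hg (kernelTest b x hx)
  simp only [testDeriv_kernelTest, mul_neg, integral_neg, neg_inj] at hweak
  rw [fderiv_mollify_apply b hu, mollify_apply]
  exact hweak

/-- A sequence of bump functions shrinking to the origin. -/
def bump (d k : ℕ) : ContDiffBump (0 : E d) where
  rIn := 1 / ((k : ℝ) + 1) / 2
  rOut := 1 / ((k : ℝ) + 1)
  rIn_pos := by positivity
  rIn_lt_rOut := half_lt_self (by positivity)

theorem tendsto_bump_rOut :
    Filter.Tendsto (fun k => (bump d k).rOut) Filter.atTop (𝓝 0) :=
  tendsto_one_div_add_atTop_nhds_zero_nat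

theorem ae_tendsto_mollify {u : E d → ℂ} (hu : MemLp u ∞ (vol Ω)) :
    ∀ᵐ x ∂(vol Ω), Filter.Tendsto (fun k => mollify Ω (bump d k) u x) Filter.atTop (𝓝 (u x)) := by
  have hlim := ContDiffBump.ae_convolution_tendsto_right_of_locallyIntegrable (K := 2)
    (tendsto_bump_rOut (d := d)) (.of_forall fun k => by simp only [bump]; linarith)
    (locallyIntegrable_indicator hu)
  filter_upwards [ae_restrict_of_ae hlim, ae_restrict_mem Ω.isOpen.measurableSet] with x hx hxΩ
  rwa [Set.indicator_of_mem hxΩ] at hx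

end Mollification

section Multipliers

open scoped Topology

/-- The product of a smooth function and a test function. -/
def smoothMul (q : E d → ℂ) (hq : ContDiff ℝ ((⊤ : ℕ∞) : WithTop ℕ∞) q) (φ : 𝓓(Ω, ℂ)) :
    𝓓(Ω, ℂ) where
  toFun x := q x * φ x
  contDiff' := hq.mul φ.contDiff
  hasCompactSupport' := φ.hasCompactSupport.mul_left
  tsupport_subset' := tsupport_mul_subset_right.trans φ.tsupport_subset

theorem testL2_smoothMul {q : E d → ℂ} (hq : ContDiff ℝ ((⊤ : ℕ∞) : WithTop ℕ∞) q)
    (hq' : MemLp q ∞ (vol Ω)) (φ : 𝓓(Ω, ℂ)) :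
    testL2 (smoothMul q hq φ) = mulL2 hq' (testL2 φ) := by
  refine Lp.ext ?_
  filter_upwards [coeFn_testL2 (smoothMul q hq φ), coeFn_testL2 φ, coeFn_mulL2 hq' (testL2 φ)]
    with x hx hφ hmul
  rw [hx, hmul, hφ]
  rfl

theorem testDeriv_smoothMul {q : E d → ℂ} (hq : ContDiff ℝ ((⊤ : ℕ∞) : WithTop ℕ∞) q)
    (φ : 𝓓(Ω, ℂ)) (i : Fin d) (x : E d) :
    testDeriv i (smoothMul q hq φ) x = q x * testDeriv i φ x + fderiv ℝ q x (e i) * φ x := by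
  have hprod := fderiv_mul (hq.differentiable (by simp) x) (differentiable_test φ x)
  calc testDeriv i (smoothMul q hq φ) x
      = q x * testDeriv i φ x + φ x * fderiv ℝ q x (e i) := DFunLike.congr_fun hprod (e i)
    _ = _ := by rw [mul_comm (φ x)]

theorem tendsto_testL2_mollify_mul {u : E d → ℂ} (hu : MemLp u ∞ (vol Ω)) (φ : 𝓓(Ω, ℂ)) :
    Filter.Tendsto (fun k => testL2 (smoothMul (mollify Ω (bump d k) u) (contDiff_mollify _ hu) φ))
      Filter.atTop (𝓝 (mulL2 hu (testL2 φ))) := by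
  obtain ⟨C, hC⟩ := exists_ae_norm_le_of_memLp_top (memLp_indicator hu)
  have hbound : ∀ k, ∀ᵐ x ∂(vol Ω), ‖mollify Ω (bump d k) u x‖ ≤ C := fun k =>
    .of_forall (norm_mollify_le _ hC)
  have hmem : ∀ k, MemLp (mollify Ω (bump d k) u) ∞ (vol Ω) := fun k =>
    memLp_top_of_bound (contDiff_mollify _ hu).continuous.aestronglyMeasurable C (hbound k)
  simp only [testL2_smoothMul _ (hmem _)]
  exact tendsto_mulL2 hmem hu hbound (ae_tendsto_mollify hu) (testL2 φ)

theorem eventually_fderiv_mollify_mul {u g : E d → ℂ} {i : Fin d} (hu : MemLp u ∞ (vol Ω))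
    (hg : IsWeakDeriv Ω i u g) (φ : 𝓓(Ω, ℂ)) : ∀ᶠ k in Filter.atTop, ∀ x,
      fderiv ℝ (mollify Ω (bump d k) u) x (e i) * φ x = mollify Ω (bump d k) g x * φ x := by
  obtain ⟨δ, hδ, hδΩ⟩ := φ.hasCompactSupport.isCompact.exists_cthickening_subset_open Ω.isOpen
    φ.tsupport_subset
  filter_upwards [(tendsto_bump_rOut (d := d)).eventually (eventually_le_nhds hδ)] with k hk x
  by_cases hx : x ∈ tsupport φ
  · rw [fderiv_mollify hu hg]
    exact (Metric.closedBall_subset_closedBall hk).trans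
      ((Metric.closedBall_subset_cthickening hx δ).trans hδΩ)
  · rw [image_eq_zero_of_notMem_tsupport hx, mul_zero, mul_zero]

theorem tendsto_testL2_testDeriv_mollify_mul {u g : E d → ℂ} {i : Fin d} (hu : MemLp u ∞ (vol Ω))
    (hg : MemLp g ∞ (vol Ω)) (hug : IsWeakDeriv Ω i u g) (φ : 𝓓(Ω, ℂ)) :
    Filter.Tendsto
      (fun k => testL2 (testDeriv i (smoothMul (mollify Ω (bump d k) u) (contDiff_mollify _ hu) φ)))
      Filter.atTop (𝓝 (mulL2 hu (testL2 (testDeriv i φ)) + mulL2 hg (testL2 φ))) := by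
  refine ((tendsto_testL2_mollify_mul hu (testDeriv i φ)).add
    (tendsto_testL2_mollify_mul hg φ)).congr' ?_
  filter_upwards [eventually_fderiv_mollify_mul hu hug φ] with k hk
  rw [← testL2_add]
  congr 1
  ext x
  rw [testDeriv_smoothMul, hk x]
  rfl

variable {q : E d → ℂ} {g : Fin d → E d → ℂ}

/-- The Leibniz rule on jets: `(u, ∇u) ↦ (qu, q∇u + ug)`, where `g` stands for `∇q`. -/
def mulJet (hq : MemLp q ∞ (vol Ω)) (hg : ∀ i, MemLp (g i) ∞ (vol Ω)) : Jet1 Ω →L[ℂ] Jet1 Ω :=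
  let value := WithLp.fstL 2 ℂ (L2 Ω) (PiLp 2 fun _ : Fin d => L2 Ω)
  let gradient := WithLp.sndL 2 ℂ (L2 Ω) (PiLp 2 fun _ : Fin d => L2 Ω)
  (WithLp.prodContinuousLinearEquiv 2 ℂ _ _).symm.toContinuousLinearMap ∘L
    (mulL2 hq ∘L value).prod
      ((PiLp.continuousLinearEquiv 2 ℂ _).symm.toContinuousLinearMap ∘L
        ContinuousLinearMap.pi fun i =>
          mulL2 hq ∘L PiLp.proj 2 _ i ∘L gradient + mulL2 (hg i) ∘L value)

theorem mulJet_mem_H10 (hq : MemLp q ∞ (vol Ω)) (hg : ∀ i, MemLp (g i) ∞ (vol Ω))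
    (hqg : ∀ i, IsWeakDeriv Ω i q (g i)) (u : H10 Ω) : mulJet hq hg u ∈ H10 Ω := by
  refine denseRange_testH10.induction_on u (p := fun u : H10 Ω => mulJet hq hg u ∈ H10 Ω)
    (isClosed_H10.preimage (by fun_prop)) fun φ => ?_
  let θ : ℕ → 𝓓(Ω, ℂ) := fun k => smoothMul (mollify Ω (bump d k) q) (contDiff_mollify _ hq) φ
  refine isClosed_H10.mem_of_tendsto (f := fun k => testJet1 (θ k)) (b := Filter.atTop) ?_
    (.of_forall fun k => (testH10 (θ k)).2)
  have hgrad := (PiLp.continuous_toLp 2 fun _ : Fin d => L2 Ω).continuousAt.tendsto.comp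
    (tendsto_pi_nhds.2 fun i => tendsto_testL2_testDeriv_mollify_mul hq (hg i) (hqg i) φ)
  exact ((WithLp.prod_continuous_toLp 2 (L2 Ω) (PiLp 2 fun _ : Fin d => L2 Ω)).tendsto _).comp
    ((tendsto_testL2_mollify_mul hq φ).prodMk_nhds hgrad)

/-- Multiplication by `q ∈ W^{1,∞}(Ω)` on `H₀¹(Ω)`, where `g` stands for `∇q`. -/
def H10.mulL (hq : MemLp q ∞ (vol Ω)) (hg : ∀ i, MemLp (g i) ∞ (vol Ω))
    (hqg : ∀ i, IsWeakDeriv Ω i q (g i)) : H10 Ω →L[ℂ] H10 Ω :=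
  (mulJet hq hg ∘L (H10 Ω).subtypeL).codRestrict (H10 Ω) (mulJet_mem_H10 hq hg hqg)

theorem toL2_mulL (hq : MemLp q ∞ (vol Ω)) (hg : ∀ i, MemLp (g i) ∞ (vol Ω))
    (hqg : ∀ i, IsWeakDeriv Ω i q (g i)) (u : H10 Ω) :
    H10.toL2 Ω (H10.mulL hq hg hqg u) = mulL2 hq (H10.toL2 Ω u) := rfl

theorem grad_mulL (hq : MemLp q ∞ (vol Ω)) (hg : ∀ i, MemLp (g i) ∞ (vol Ω))
    (hqg : ∀ i, IsWeakDeriv Ω i q (g i)) (u : H10 Ω) (i : Fin d) :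
    H10.grad Ω (H10.mulL hq hg hqg u) i =
      mulL2 hq (H10.grad Ω u i) + mulL2 (hg i) (H10.toL2 Ω u) := rfl

end Multipliers

section Products

theorem IsProduct.unique {q : E d → ℝ} {u w w' : H10 Ω} (h : IsProduct q u w)
    (h' : IsProduct q u w') : w = w' :=
  H10.toL2_injective (Lp.ext (h.trans h'.symm))

theorem IsProduct.existsUnique {q : E d → ℝ} {u w : H10 Ω} (h : IsProduct q u w) :
    ∃! w : H10 Ω, IsProduct q u w :=
  ⟨w, h, fun _ h' => h'.unique h⟩

theorem IsProduct.mulH10_eq {q : E d → ℝ} {u w : H10 Ω} (h : IsProduct q u w) :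
    mulH10 q u = w := by
  have hex : ∃ w : H10 Ω, IsProduct q u w := ⟨w, h⟩
  rw [mulH10, dif_pos hex]
  exact hex.choose_spec.unique h

theorem exists_le_re_inner_grad_mulL {q : E d → ℂ} {g : Fin d → E d → ℂ}
    (hq : MemLp q ∞ (vol Ω)) (hg : ∀ i, MemLp (g i) ∞ (vol Ω))
    (hqg : ∀ i, IsWeakDeriv Ω i q (g i)) {δ : ℝ} (hδ : ∀ᵐ x ∂(vol Ω), δ ≤ (q x).re) :
    ∃ C : ℝ, ∀ u : H10 Ω, δ * ‖H10.grad Ω u‖ ^ 2 - C * (‖H10.grad Ω u‖ * ‖H10.toL2 Ω u‖) ≤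
      (inner ℂ (H10.grad Ω u) (H10.grad Ω (H10.mulL hq hg hqg u))).re := by
  refine ⟨∑ i, ‖mulL2 (hg i)‖, fun u => ?_⟩
  have hcoord : ∀ i, δ * ‖H10.grad Ω u i‖ ^ 2 -
      ‖mulL2 (hg i)‖ * (‖H10.grad Ω u‖ * ‖H10.toL2 Ω u‖) ≤
        (inner ℂ (H10.grad Ω u i) (H10.grad Ω (H10.mulL hq hg hqg u) i)).re := fun i => by
    rw [grad_mulL, inner_add_right, Complex.add_re, sub_eq_add_neg]
    refine add_le_add (le_re_inner_mulL2 hq hδ _) (neg_le.1 ?_)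
    calc -(inner ℂ (H10.grad Ω u i) (mulL2 (hg i) (H10.toL2 Ω u))).re
        ≤ ‖inner ℂ (H10.grad Ω u i) (mulL2 (hg i) (H10.toL2 Ω u))‖ :=
          (neg_le_abs _).trans (Complex.abs_re_le_norm _)
      _ ≤ ‖H10.grad Ω u‖ * (‖mulL2 (hg i)‖ * ‖H10.toL2 Ω u‖) :=
          (norm_inner_le_norm _ _).trans (mul_le_mul (PiLp.norm_apply_le _ i)
            ((mulL2 (hg i)).le_opNorm _) (norm_nonneg _) (norm_nonneg _))
      _ = ‖mulL2 (hg i)‖ * (‖H10.grad Ω u‖ * ‖H10.toL2 Ω u‖) := by ring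
  calc δ * ‖H10.grad Ω u‖ ^ 2 - (∑ i, ‖mulL2 (hg i)‖) * (‖H10.grad Ω u‖ * ‖H10.toL2 Ω u‖)
      = ∑ i, (δ * ‖H10.grad Ω u i‖ ^ 2 -
          ‖mulL2 (hg i)‖ * (‖H10.grad Ω u‖ * ‖H10.toL2 Ω u‖)) := by
        rw [PiLp.norm_sq_eq_of_L2, Finset.mul_sum, Finset.sum_mul, Finset.sum_sub_distrib]
    _ ≤ ∑ i, (inner ℂ (H10.grad Ω u i) (H10.grad Ω (H10.mulL hq hg hqg u) i)).re :=
        Finset.sum_le_sum fun i _ => hcoord i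
    _ = _ := by rw [PiLp.inner_apply, Complex.re_sum]

theorem exists_rightInverse_mulL {q : E d → ℂ} {g : Fin d → E d → ℂ}
    (hq : MemLp q ∞ (vol Ω)) (hg : ∀ i, MemLp (g i) ∞ (vol Ω))
    (hqg : ∀ i, IsWeakDeriv Ω i q (g i)) {δ : ℝ} (hδ : 0 < δ)
    (hqδ : ∀ᵐ x ∂(vol Ω), δ ≤ (q x).re) :
    ∃ P : H10 Ω →L[ℂ] H10 Ω, ∀ u, H10.mulL hq hg hqg (P u) = u := by
  obtain ⟨C, hC⟩ := exists_le_re_inner_grad_mulL hq hg hqg hqδ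
  refine exists_rightInverse_of_coercive (𝕜 := ℂ) (X := H10 Ω) (Y := L2 Ω) (J := H10.toL2 Ω)
    (κ := C ^ 2 / (2 * δ ^ 2)) (by positivity) (half_pos hδ) fun u => ?_
  have hvalue : δ * ‖H10.toL2 Ω u‖ ^ 2 ≤
      (inner ℂ (H10.toL2 Ω u) (H10.toL2 Ω (H10.mulL hq hg hqg u))).re :=
    le_re_inner_mulL2 hq hqδ _
  have hinner : (inner ℂ u (H10.mulL hq hg hqg u)).re =
      (inner ℂ (H10.toL2 Ω u) (H10.toL2 Ω (H10.mulL hq hg hqg u))).re +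
        (inner ℂ (H10.grad Ω u) (H10.grad Ω (H10.mulL hq hg hqg u))).re := rfl
  -- AM-GM: `C a b ≤ δ a² / 2 + C² b² / (2 δ)`
  have hamgm : C * (‖H10.grad Ω u‖ * ‖H10.toL2 Ω u‖) ≤
      δ / 2 * ‖H10.grad Ω u‖ ^ 2 + C ^ 2 / (2 * δ ^ 2) * (δ * ‖H10.toL2 Ω u‖ ^ 2) := by
    rw [← sub_nonneg]
    calc (0 : ℝ) ≤ (δ * ‖H10.grad Ω u‖ - C * ‖H10.toL2 Ω u‖) ^ 2 / (2 * δ) := by positivity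
      _ = _ := by field_simp; ring
  have hκ := mul_le_mul_of_nonneg_left hvalue (show 0 ≤ C ^ 2 / (2 * δ ^ 2) by positivity)
  have hpos : 0 ≤ δ / 2 * ‖H10.toL2 Ω u‖ ^ 2 := by positivity
  rw [RCLike.re_to_complex, RCLike.re_to_complex, hinner, H10.norm_sq_eq]
  linarith [hC u]

theorem MemW1Infty.exists_isProduct {n : E d → ℝ} (hn : MemW1Infty Ω n) :
    ∃ N : H10 Ω →L[ℂ] H10 Ω, ∀ u, IsProduct n u (N u) := by
  choose g hg hng using hn.2
  exact ⟨H10.mulL hn.1.ofReal (fun i => (hg i).ofReal) hng, fun u => coeFn_mulL2 _ _⟩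

theorem MemW1Infty.exists_isProduct_one_div {m : E d → ℝ} (hm : MemW1Infty Ω m) {δ : ℝ}
    (hδ : 0 < δ) (hmδ : ∀ᵐ x ∂(vol Ω), δ ≤ m x) :
    ∃ P : H10 Ω →L[ℂ] H10 Ω, ∀ u, IsProduct (fun x => 1 / m x) u (P u) := by
  choose g hg hmg using hm.2
  obtain ⟨P, hP⟩ := exists_rightInverse_mulL hm.1.ofReal (fun i => (hg i).ofReal) hmg hδ
    (by simpa using! hmδ)
  refine ⟨P, fun u => ?_⟩
  have hmul := toL2_mulL hm.1.ofReal (fun i => (hg i).ofReal) hmg (P u)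
  rw [hP] at hmul
  rw [IsProduct, hmul]
  filter_upwards [coeFn_mulL2 hm.1.ofReal (H10.toL2 Ω (P u)), hmδ] with x hx hδx
  have hmx : (m x : ℂ) ≠ 0 := Complex.ofReal_ne_zero.2 (hδ.trans_le hδx).ne'
  simp [hx, hmx]

theorem IsProduct.trans_one_div {n m : E d → ℝ} {u v w : H10 Ω}
    (hv : IsProduct (fun x => 1 / m x) u v) (hw : IsProduct n v w) :
    IsProduct (fun x => n x / m x) u w := by
  filter_upwards [hv, hw] with x hvx hwx
  rw [hwx, hvx]
  push_cast
  ring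

end Products

section Forms

theorem isWeakDeriv_const (i : Fin d) (a : ℂ) : IsWeakDeriv Ω i (fun _ => a) fun _ => 0 := by
  intro φ
  have hφ := φ.continuous.integrable_of_hasCompactSupport (μ := volume) φ.hasCompactSupport
  have hφ' := (testDeriv i φ).continuous.integrable_of_hasCompactSupport (μ := volume)
    (testDeriv i φ).hasCompactSupport
  have hparts := integral_mul_fderiv_eq_neg_fderiv_mul_of_integrable (μ := volume) (𝕜 := ℂ)
    (f := fun _ : E d => a) (g := φ) (v := e i) (by simp) (hφ'.const_mul a)
    (hφ.const_mul a) (fun x _ => differentiableAt_const a)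
    (fun x _ => differentiable_test φ x)
  rw [setIntegral_eq_integral_of_forall_compl_eq_zero fun x hx => by
    rw [test_eq_zero_of_notMem _ hx, mul_zero]]
  simpa using! hparts

theorem integrable_mul_test_of_memLp_top {q : E d → ℂ} (hq : MemLp q ∞ (vol Ω)) (φ : 𝓓(Ω, ℂ)) :
    Integrable (fun x => q x * φ x) (vol Ω) :=
  (φ.continuous.integrable_of_hasCompactSupport φ.hasCompactSupport).integrableOn.essSup_smul
    hq.aestronglyMeasurable hq.2.ne

theorem IsWeakDeriv.const_add_const_mul {i : Fin d} {q g : E d → ℂ} (hq : MemLp q ∞ (vol Ω))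
    (h : IsWeakDeriv Ω i q g) (a c : ℂ) :
    IsWeakDeriv Ω i (fun x => a + c * q x) fun x => c * g x := by
  intro φ
  have hconst := isWeakDeriv_const i a φ
  simp only [zero_mul, integral_zero, neg_zero] at hconst
  simp only [add_mul, mul_assoc]
  rw [integral_add (integrable_mul_test_of_memLp_top (memLp_top_const a) _)
    ((integrable_mul_test_of_memLp_top hq _).const_mul c), hconst,
    integral_const_mul, integral_const_mul, h φ]
  ring

theorem MemW1Infty.const_add_const_mul {n : E d → ℝ} (hn : MemW1Infty Ω n) (a c : ℝ) :
    MemW1Infty Ω fun x => a + c * n x := by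
  refine ⟨(memLp_top_const a).add (hn.1.const_mul c), fun i => ?_⟩
  obtain ⟨g, hg, hng⟩ := hn.2 i
  refine ⟨fun x => c * g x, hg.const_mul c, ?_⟩
  simpa using! hng.const_add_const_mul hn.1.ofReal a c

theorem memW1Infty_and_exists_le_of_cond {n m : E d → ℝ} (hn : MemW1Infty Ω n)
    (hm : (CondC1 Ω n ∧ m = fun x => n x - 1) ∨ (CondC2 Ω n ∧ m = fun x => 1 - n x)) :
    MemW1Infty Ω m ∧ ∃ δ : ℝ, 0 < δ ∧ ∀ᵐ x ∂(vol Ω), δ ≤ m x := by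
  rcases hm with ⟨⟨-, δ, hδ, hnδ⟩, rfl⟩ | ⟨⟨-, -, β, hβ, hnβ⟩, rfl⟩
  · refine ⟨?_, δ, hδ, hnδ.mono fun x hx => by linarith⟩
    convert hn.const_add_const_mul (-1) 1 using 2
    ring
  · refine ⟨?_, β, hβ, hnβ.mono fun x hx => by linarith⟩
    convert hn.const_add_const_mul 1 (-1) using 2
    ring

theorem memLp_top_one_div_sub {m : E d → ℝ} (hm : AEMeasurable m (vol Ω)) {δ : ℝ} (hδ : 0 < δ)
    (hmδ : ∀ᵐ x ∂(vol Ω), δ ≤ m x) (μ : ℝ) :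
    MemLp (fun x => 1 / m x - μ) ∞ (vol Ω) := by
  refine MemLp.sub ?_ (memLp_top_const μ)
  refine memLp_top_of_bound (hm.const_div 1).aestronglyMeasurable (1 / δ) ?_
  filter_upwards [hmδ] with x hx
  rw [Real.norm_of_nonneg (one_div_nonneg.2 (hδ.le.trans hx))]
  exact one_div_le_one_div_of_le hδ hx

variable (Ω) in
/-- The Laplacian as a continuous linear operator `H₀²(Ω) → L²(Ω)`. -/
def H20.laplacianL : H20 Ω →L[ℂ] L2 Ω :=
  ∑ i, PiLp.proj 2 (fun _ : Fin d × Fin d => L2 Ω) (i, i) ∘L H20.hess Ω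

theorem H20.laplacianL_apply (u : H20 Ω) : H20.laplacianL Ω u = H20.laplacian u :=
  _root_.sum_apply _ _ _

theorem integral_sum_mul_conj {κ : Type*} [Fintype κ] (u v : PiLp 2 fun _ : κ => L2 Ω) :
    ∫ x in (Ω : Set (E d)), ∑ i, u i x * conj (v i x) = inner ℂ v u := by
  simp only [PiLp.inner_apply, inner_eq_integral]
  exact integral_finsetSum _ fun i _ => L2.integrable_inner (v i) (u i)

theorem formA_eq {m : E d → ℝ} {μ : ℝ}
    (hq : MemLp (fun x => ((1 / m x - μ : ℝ) : ℂ)) ∞ (vol Ω)) (U V : HH Ω) :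
    formA Ω m μ U V = inner ℂ (H20.laplacianL Ω V.1) (mulL2 hq (H20.laplacianL Ω U.1)) +
      μ * inner ℂ (H20.hess Ω V.1) (H20.hess Ω U.1) + inner ℂ V.2 U.2 := by
  rw [inner_mulL2, ← integral_sum_mul_conj, inner_eq_integral, H20.laplacianL_apply,
    H20.laplacianL_apply]
  simp only [Fintype.sum_prod_type]
  rfl

theorem formB_eq {n m : E d → ℝ} {P Q : H10 Ω → H10 Ω}
    (hP : ∀ u, IsProduct (fun x => 1 / m x) u (P u))
    (hQ : ∀ u, IsProduct (fun x => n x / m x) u (Q u)) (F : HH1 Ω) (V : HH Ω) :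
    formB Ω n m F V =
      inner ℂ (H10.grad Ω (H20.toH10 Ω V.1)) (H10.grad Ω (P F.1)) +
        inner ℂ (H10.grad Ω (Q (H20.toH10 Ω V.1))) (H10.grad Ω F.1) -
        F.2 (Q (H20.toH10 Ω V.1)) + inner ℂ V.2 (H10.toL2 Ω F.1) := by
  rw [← integral_sum_mul_conj, ← integral_sum_mul_conj, inner_eq_integral, formB]
  simp only [(hP _).mulH10_eq, (hQ _).mulH10_eq]
  rfl

theorem exists_solution_operator [NeZero d] (hΩ : Bornology.IsBounded (Ω : Set (E d)))
    {n m : E d → ℝ} {μ : ℝ} (hq : MemLp (fun x => ((1 / m x - μ : ℝ) : ℂ)) ∞ (vol Ω))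
    (hμ : 0 < μ) (hμm : ∀ᵐ x ∂(vol Ω), μ ≤ 1 / m x) {P Q : H10 Ω →L[ℂ] H10 Ω}
    (hP : ∀ u, IsProduct (fun x => 1 / m x) u (P u))
    (hQ : ∀ u, IsProduct (fun x => n x / m x) u (Q u)) :
    ∃ T : HH1 Ω →L[ℂ] HH Ω, ∀ (F : HH1 Ω) (U : HH Ω),
      (∀ V : HH Ω, formA Ω m μ U V = formB Ω n m F V) ↔ U = T F := by
  have hnonneg (w : L2 Ω) : 0 ≤ RCLike.re (inner ℂ w (mulL2 hq w)) := by
    have h := le_re_inner_mulL2 hq (δ := 0) (by simpa using! hμm) w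
    rwa [zero_mul] at h
  obtain ⟨C, hC, hpoincare⟩ := exists_norm_sq_le_norm_sq_hess hΩ
  obtain ⟨S, hS⟩ := exists_forall_inner_add_inner_eq_iff (𝕜 := ℂ) (X := H20 Ω) (Y := L2 Ω)
    (L := H20.laplacianL Ω) (M := mulL2 hq) (K := H20.hess Ω) hnonneg hμ hC
    -- unfolding the norms of the two spaces is prohibitively slow
    (by with_reducible_and_instances exact hpoincare)
  obtain ⟨R, hR⟩ := exists_inner_eq_sub (𝕜 := ℂ) (X := H20 Ω) (X₁ := H10 Ω) (H20.toH10 Ω)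
    (H10.grad Ω) P Q
  refine ⟨(S ∘L R).prod (H10.toL2 Ω ∘L .fst ℂ _ _), fun F U => ?_⟩
  simp only [formA_eq hq, formB_eq hP hQ, ← hR]
  constructor
  · intro h
    refine Prod.ext ((hS U.1 (R F)).1 fun v => ?_) (ext_inner_left ℂ fun z => ?_)
    · simpa using! h (v, 0)
    · simpa using! h (0, z)
  · rintro rfl V
    exact congrArg (· + _) ((hS (S (R F)) (R F)).2 rfl V.1)

end Forms

end TransmissionEigenvalue

end

open TransmissionEigenvalue in
theorem theorem2p2_general {d : ℕ} [NeZero d]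
    {Ω : TopologicalSpace.Opens (EuclideanSpace ℝ (Fin d))}
    (hΩ : Bornology.IsBounded (Ω : Set (EuclideanSpace ℝ (Fin d))))
    {n m : EuclideanSpace ℝ (Fin d) → ℝ} (hn : MemW1Infty Ω n) (hm : MemW1Infty Ω m)
    {δ : ℝ} (hδ : 0 < δ) (hmδ : ∀ᵐ x ∂(vol Ω), δ ≤ m x)
    {μ : ℝ} (hμ : 0 < μ) (hμm : ∀ᵐ x ∂(vol Ω), μ ≤ 1 / m x) :
    (∀ f : H10 Ω, ∃! w : H10 Ω, IsProduct (fun x => 1 / m x) f w) ∧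
    (∀ v : H10 Ω, ∃! w : H10 Ω, IsProduct (fun x => n x / m x) v w) ∧
    ∃ T : HH1 Ω →L[ℂ] HH Ω,
      (∀ (F : HH1 Ω) (Y : HH Ω), (∀ V : HH Ω, formA Ω m μ Y V = formB Ω n m F V) ↔ Y = T F) ∧
      IsCompactOperator (T ∘L incl Ω) ∧
      IsCompactOperator (incl Ω ∘L T) := by
  obtain ⟨P, hP⟩ := hm.exists_isProduct_one_div hδ hmδ
  obtain ⟨N, hN⟩ := hn.exists_isProduct
  have hQ : ∀ v, IsProduct (fun x => n x / m x) v ((N ∘L P) v) :=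
    fun v => (hP v).trans_one_div (hN (P v))
  have hq := (memLp_top_one_div_sub hm.1.aestronglyMeasurable.aemeasurable hδ hmδ μ).ofReal (K := ℂ)
  obtain ⟨T, hT⟩ := exists_solution_operator hΩ hq hμ hμm hP hQ
  exact ⟨fun f => (hP f).existsUnique, fun v => (hQ v).existsUnique, T, hT,
    (isCompactOperator_incl hΩ).clm_comp T, (isCompactOperator_incl hΩ).comp_clm T⟩

open TransmissionEigenvalue in
theorem theorem2p2 (d : ℕ) (hd : d = 2 ∨ d = 3)
    (Ω : TopologicalSpace.Opens (EuclideanSpace ℝ (Fin d)))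
    (hΩb : Bornology.IsBounded (Ω : Set (EuclideanSpace ℝ (Fin d))))
    (hΩc : SimplyConnectedSpace Ω)
    (n m : EuclideanSpace ℝ (Fin d) → ℝ)
    (hn : MemW1Infty Ω n)
    (hm : (CondC1 Ω n ∧ m = fun x => n x - 1) ∨ (CondC2 Ω n ∧ m = fun x => 1 - n x))
    (μ : ℝ) (hμ : 0 < μ) (hμm : ∀ᵐ x ∂(vol Ω), μ ≤ 1 / m x) :
    -- the products occurring in `B` are well defined elements of `H₀¹(Ω)`
    (∀ f : H10 Ω, ∃! w : H10 Ω, IsProduct (fun x => 1 / m x) f w) ∧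
    (∀ v : H10 Ω, ∃! w : H10 Ω, IsProduct (fun x => n x / m x) v w) ∧
    -- the solution operator exists, and is compact on both spaces
    ∃ T : HH1 Ω →L[ℂ] HH Ω,
      (∀ (F : HH1 Ω) (Y : HH Ω), (∀ V : HH Ω, formA Ω m μ Y V = formB Ω n m F V) ↔ Y = T F) ∧
      IsCompactOperator (T ∘L incl Ω) ∧
      IsCompactOperator (incl Ω ∘L T) := by
  have : NeZero d := ⟨by omega⟩
  obtain ⟨hmW, δ, hδ, hmδ⟩ := memW1Infty_and_exists_le_of_cond hn hm
  exact theorem2p2_general hΩb hn hmW hδ hmδ hμ hμm
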